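/- Let $\mathcal X,\mathcal Y$ be finite alphabets, $W(y|x)$ a discrete memoryless channel from $\mathcal X$ to $\mathcal Y$, $W^n(\mathbf y|\mathbf x)=\prod_k W(y_k|x_k)$, $P$ a probability mass function on $\mathcal X$, $q:\mathcal P(\mathcal X\times\mathcal Y)\to\mathbb R$ a continuous function on the probability simplex, $R\in\mathbb R$ and $\epsilon>0$. Logarithms are natural, $\hat P$ denotes (joint) empirical distributions (types), and for sequences we write $q(\mathbf x,\mathbf y)=q(\hat P_{\mathbf x\mathbf y})$ and $d(\mathbf x,\mathbf x')=d(\hat P_{\mathbf x\mathbf x'})$. **Csiszár–Körner exponent.** Let $$E_q(R,P,W)=\min_{V\in\mathcal T_I} D(V_{Y|X}\|W|P)+\bigl|I_V(\widetilde X;Y,X)-R\bigr|_+\in[0,\infty],$$ where $|t|_+=\max\{t,0\}$, $D(V_{Y|X}\|W|P)=\sum_x P(x)\sum_y V(y|x)\log\frac{V(y|x)}{W(y|x)}$, which is $+\infty$ if $V_{XY}(x,y)>0=W(y|x)$ for some $(x,y)$, and $\mathcal T_I$ is the set of all $V_{X\widetilde XY}\in\mathcal P(\mathcal X\times\mathcal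 X\times\mathcal Y)$ with $V_X=V_{\widetilde X}=P$, $q(V_{\widetilde XY})\ge q(V_{XY})$ and $I_V(X;\widetilde X)\le R$ (a minimum over the empty set is $+\infty$). **RGV construction.** Let $d:\mathcal P(\mathcal X\times\mathcal X)\to\mathbb R$ be a distance function, that is, $d$ is bounded, continuous, and symmetric (invariant under exchanging the two components), and let $\Delta\in\mathbb R$ and $\delta>0$. Let $P_n$ be an arbitrary type of sequences of length $n$ with the same support as $P$ and $\max_x|P_n(x)-P(x)|\le 1/n$, and let $\mathcal T(P_n)$ be its type class. The generalized random Gilbert–Varshamov (RGV) construction with $M_n=\mathrm e^{nR_n}$ codewords draws $\mathbf x_1$ uniformly from $\mathcal T(P_n)$ and then, successively, $\mathbf x_i$ uniformly from $\{\mathbf x\in\mathcal T(P_n): d(\mathbf x,\mathbf x_j)>\Delta,\ j=1,\dots,i-1\}$. It is subject to the condition $$\mathrm e^{n(R_n+\delta)}\,\bigl|\{\bar{\mathbf x}\in\mathcal T(P_n): d(\bar{\mathbf x},\mathbf x)\le\Delta\}\bigr|\le|\mathcal T(P_n)|\qquad(\mathbf x\in\mathcal T(P_n)).\tag{1}$$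 The message $m$ is uniform on $\{1,\dots,M_n\}$. The decoder maximizes $q(\mathbf x_i,\mathbf y)$ over $i$, ties counting as errors: if $m$ is sent and $\mathbf y$ is received, an error occurs iff $q(\mathbf x_i,\mathbf y)\ge q(\mathbf x_m,\mathbf y)$ for some $i\ne m$. Let $\bar P_{\mathrm e}^{(n)}$ be the error probability averaged over the message, the channel and the random codebook. **Claim.** 1. The function $d(P_{X\widetilde X})=-I(X;\widetilde X)$ is a distance function in the above sense. 2. For every $\delta>0$, the choices $d(P_{X\widetilde X})=-I(X;\widetilde X)$ and $\Delta=-(R+2\delta)$ satisfy the rate condition $$R\le\min_{P_{X\widetilde X}:\ d(P_{X\widetilde X})\le\Delta,\ P_X=P_{\widetilde X}=P} I(X;\widetilde X)-2\delta .$$ 3. There is $\delta_0>0$ such that for every $\delta\in(0,\delta_0)$ there is $N$ such that for all $n\ge N$, every $P_n$ as above and every integer $M_n$ with $1\le M_n\le\mathrm e^{nR}$, the RGV construction with $d(P_{X\widetilde X})=-I(X;\widetilde X)$ and $\Delta=-(R+2\delta)$ satisfies (1), never runs out of sequences (so that it defines a probability distribution on codebooks), and its ensemble average error probability satisfies $$-\frac1n\log\bar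 P_{\mathrm e}^{(n)}\ \ge\ E_q(R,P,W)-\epsilon .$$ Here $-\log 0=\infty$; in particular, $\bar P_{\mathrm e}^{(n)}=0$ for all such $n$ if $E_q(R,P,W)=\infty$. -/

import Mathlib

/-! Generalized random Gilbert-Varshamov (RGV) codes over a discrete memoryless channel.
Probability mass functions on a finite alphabet `A` are the elements of `stdSimplex ℝ A`;
all information quantities are in nats. -/

namespace RGV

open Finset

/-! ### Types and information quantities -/

open Classical in
/-- The type (empirical distribution) of a sequence. -/
noncomputable def empirical {A : Type*} {n : ℕ} (x : Fin n → A) : A → ℝ :=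
  fun a => (#{k | x k = a} : ℝ) / n

/-- The joint type of two sequences. -/
noncomputable def jointType {A B : Type*} {n : ℕ} (x : Fin n → A) (y : Fin n → B) :
    A × B → ℝ :=
  empirical fun k => (x k, y k)

open Classical in
/-- The type class of `p`: all sequences of length `n` with type `p`. -/
noncomputable def typeClass {A : Type*} [Fintype A] (n : ℕ) (p : A → ℝ) :
    Finset (Fin n → A) :=
  {x | empirical x = p}

/-- `Pn` is a type of sequences of length `n` that has the same support as `P` and differs
from `P` by at most `1 / n` in each coordinate. -/
def IsApproxType {A : Type*} (P : A → ℝ) (n : ℕ) (Pn : A → ℝ) : Prop :=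
  (∃ x : Fin n → A, empirical x = Pn) ∧ (∀ a, Pn a = 0 ↔ P a = 0) ∧
    ∀ a, |Pn a - P a| ≤ 1 / n

/-- First marginal of a joint distribution. -/
def marginalFst {A B : Type*} [Fintype B] (Q : A × B → ℝ) : A → ℝ :=
  fun a => ∑ b, Q (a, b)

/-- Second marginal of a joint distribution. -/
def marginalSnd {A B : Type*} [Fintype A] (Q : A × B → ℝ) : B → ℝ :=
  fun b => ∑ a, Q (a, b)

/-- Mutual information of the two components of the joint distribution `Q`
(a summand with `Q c = 0` is `0`). -/
noncomputable def mutualInfo {A B : Type*} [Fintype A] [Fintype B] (Q : A × B → ℝ) : ℝ :=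
  ∑ c : A × B, Q c * Real.log (Q c / (marginalFst Q c.1 * marginalSnd Q c.2))

open Classical in
/-- The conditional divergence `D(U_{Y|X} ‖ W | U_X)` for a joint distribution `U` of `(X, Y)`;
it is `⊤` if `U` charges a pair `(x, y)` with `W(y|x) = 0`. -/
noncomputable def condDiv {X Y : Type*} [Fintype X] [Fintype Y] (U : X × Y → ℝ)
    (W : X → Y → ℝ) : EReal :=
  if ∀ x y, W x y = 0 → U (x, y) = 0 then
    ((∑ x, ∑ y, U (x, y) * Real.log (U (x, y) / marginalFst U x / W x y) : ℝ) : EReal)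
  else ⊤

/-! ### The Csiszár-Körner exponent

A joint distribution `V` of `(X, X', Y)` is a function on `X × X × Y`, with `X'` standing for
the second input letter. -/

/-- The marginal of `(X, X')`. -/
def margXX {X Y : Type*} [Fintype Y] (V : X × X × Y → ℝ) : X × X → ℝ :=
  fun c => ∑ y, V (c.1, c.2, y)

/-- The marginal of `(X, Y)`. -/
def margXY {X Y : Type*} [Fintype X] (V : X × X × Y → ℝ) : X × Y → ℝ :=
  fun c => ∑ x', V (c.1, x', c.2)

/-- The marginal of `(X', Y)`. -/
def margX'Y {X Y : Type*} [Fintype X] (V : X × X × Y → ℝ) : X × Y → ℝ :=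
  fun c => ∑ x, V (x, c.1, c.2)

/-- The mutual information `I(X'; Y, X)`. -/
noncomputable def infoX'YX {X Y : Type*} [Fintype X] [Fintype Y] (V : X × X × Y → ℝ) : ℝ :=
  mutualInfo fun c : X × (X × Y) => V (c.2.1, c.1, c.2.2)

/-- The constraint set of the Csiszár-Körner exponent: `V_X = V_{X'} = P`,
`q(V_{X'Y}) ≥ q(V_{XY})` and `I(X; X') ≤ R`. -/
def ckSet {X Y : Type*} [Fintype X] [Fintype Y] (q : (X × Y → ℝ) → ℝ) (R : ℝ) (P : X → ℝ) :
    Set (X × X × Y → ℝ) :=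
  {V | V ∈ stdSimplex ℝ (X × X × Y) ∧ marginalFst (margXX V) = P ∧
    marginalSnd (margXX V) = P ∧ q (margXY V) ≤ q (margX'Y V) ∧ mutualInfo (margXX V) ≤ R}

/-- The Csiszár-Körner exponent
`E_q(R, P, W) = min_V D(V_{Y|X} ‖ W | P) + |I(X'; Y, X) - R|₊`, possibly `⊤`. -/
noncomputable def ckExponent {X Y : Type*} [Fintype X] [Fintype Y] (q : (X × Y → ℝ) → ℝ)
    (R : ℝ) (P : X → ℝ) (W : X → Y → ℝ) : EReal :=
  ⨅ V ∈ ckSet q R P, condDiv (margXY V) W + ((max (infoX'YX V - R) 0 : ℝ) : EReal)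

/-! ### Distance functions -/

/-- The class `Ω` of bounded, continuous, symmetric, type-dependent distance functions;
the distance of two sequences is the value at their joint type. -/
def IsDistanceFunction {X : Type*} [Fintype X] (d : (X × X → ℝ) → ℝ) : Prop :=
  ContinuousOn d (stdSimplex ℝ (X × X)) ∧
    (∃ B : ℝ, ∀ Q ∈ stdSimplex ℝ (X × X), |d Q| ≤ B) ∧
    ∀ Q ∈ stdSimplex ℝ (X × X), d (fun c => Q c.swap) = d Q

/-- The distance `d(P_{XX'}) = -I(X; X')`. -/
noncomputable def negInfo {X : Type*} [Fintype X] (Q : X × X → ℝ) : ℝ := -mutualInfo Q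

/-- The rate condition
`R ≤ min {I(X; X') : d(P_{XX'}) ≤ Δ, P_X = P_{X'} = P} - 2 δ`
(a minimum over the empty set is `⊤`). -/
def RateCondition {X : Type*} [Fintype X] (R : ℝ) (P : X → ℝ) (d : (X × X → ℝ) → ℝ)
    (Δ δ : ℝ) : Prop :=
  (R : EReal) ≤
    (⨅ Q ∈ {Q : X × X → ℝ | Q ∈ stdSimplex ℝ (X × X) ∧ d Q ≤ Δ ∧
        marginalFst Q = P ∧ marginalSnd Q = P}, (mutualInfo Q : EReal)) - ((2 * δ : ℝ) : EReal)

/-! ### The recursive random codebook -/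

open Classical in
/-- The sequences of the type class of `Pn` whose distance to the codewords of `c` with an
index smaller than `i` exceeds `Δ`. -/
noncomputable def admissible {X : Type*} [Fintype X] {n M : ℕ} (Pn : X → ℝ)
    (d : (X × X → ℝ) → ℝ) (Δ : ℝ) (c : Fin M → Fin n → X) (i : Fin M) : Finset (Fin n → X) :=
  {x ∈ typeClass n Pn | ∀ j < i, Δ < d (jointType x (c j))}

open Classical in
/-- The probability of the codebook `c` in the RGV construction: the `i`-th codeword is
uniform on the admissible sequences, given the codewords before it. -/
noncomputable def codebookProb {X : Type*} [Fintype X] {n M : ℕ} (Pn : X → ℝ)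
    (d : (X × X → ℝ) → ℝ) (Δ : ℝ) (c : Fin M → Fin n → X) : ℝ :=
  ∏ i, if c i ∈ admissible Pn d Δ c i then 1 / (#(admissible Pn d Δ c i) : ℝ) else 0

open Classical in
/-- The condition `e^{n (Rₙ + δ)} vol_x(Δ) ≤ |T(Pn)|` with `Rₙ = (1 / n) log M`, which the RGV
construction is subject to. -/
def VolumeCondition {X : Type*} [Fintype X] (n M : ℕ) (Pn : X → ℝ)
    (d : (X × X → ℝ) → ℝ) (Δ δ : ℝ) : Prop :=
  ∀ x ∈ typeClass n Pn,
    Real.exp (n * (Real.log M / n + δ)) * (#{z ∈ typeClass n Pn | d (jointType z x) ≤ Δ} : ℝ) ≤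
      (#(typeClass n Pn) : ℝ)

/-! ### Error probabilities -/

/-- The memoryless extension `Wⁿ(y|x)`. -/
def channelPow {X Y : Type*} {n : ℕ} (W : X → Y → ℝ) (x : Fin n → X) (y : Fin n → Y) : ℝ :=
  ∏ k, W (x k) (y k)

open Classical in
/-- The error probability of the codebook `c` for an equiprobable message under the
maximum-metric decoder, ties counting as errors. -/
noncomputable def errorProb {X Y : Type*} [Fintype Y] {n M : ℕ} (W : X → Y → ℝ)
    (q : (X × Y → ℝ) → ℝ) (c : Fin M → Fin n → X) : ℝ :=
  1 / (M : ℝ) * ∑ m, ∑ y : Fin n → Y,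
    if ∃ i, i ≠ m ∧ q (jointType (c m) y) ≤ q (jointType (c i) y)
      then channelPow W (c m) y else 0

/-- The ensemble average error probability of the RGV construction with `M` codewords of
length `n`. -/
noncomputable def ensembleErrorProb {X Y : Type*} [Fintype X] [Fintype Y] (n M : ℕ)
    (Pn : X → ℝ) (d : (X × X → ℝ) → ℝ) (Δ : ℝ) (W : X → Y → ℝ) (q : (X × Y → ℝ) → ℝ) : ℝ :=
  ∑ c : Fin M → Fin n → X, codebookProb Pn d Δ c * errorProb W q c

open Classical in
/-- The exponent `-(1 / n) log p`, equal to `⊤` if `p = 0`. -/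
noncomputable def exponent (n : ℕ) (p : ℝ) : EReal :=
  if p = 0 then ⊤ else ((-(1 / n) * Real.log p : ℝ) : EReal)

end RGV

namespace RGV

open Finset

/-! ### Empirical distributions -/

section Types

variable {A B C : Type*} {n : ℕ}

/-! The proof is by the method of types. Write `T` for the type class of `Pn` and suppose `e^{nδ} ≥
2`. By the volume condition, the balls around all codewords together cover at most half of `T`. So
every draw is uniform on at least `|T|/2` sequences: the construction never runs out, and given the
past each sequence is drawn with probability at most `2/|T|`. A given pair of codewords therefore
takes a given pair of values with probability at most `(2/|T|)²`, as under independent draws up to a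
constant (`HalfCover.prob_codewords_eq_le`). Unlike independent draws, the construction never
produces a pair with `I(x; x') ≥ R + 2δ`.

A union bound truncated at 1 bounds the error by an average of `min 1 (M · 2/|T| · #confusable)`,
which is split over the joint types `V` of (sent word, competitor, output). Given the sent word and
the output, the competitors of type `V` number at most poly · `|T| e^{-n I(X';Y,X)}`. Given the sent
word, the outputs of the right joint type have total probability at most `e^{-nD}`. With `M ≤
e^{nR}`, each `V` contributes at most poly · `e^{-n(D + |I - R|₊)}` (`sum_channelPow_mul_min_le`),
and there are only polynomially many `V`. The same counting of fibres gives the volume condition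
(`card_negInfo_le`).

The types that occur satisfy the constraints of `ckSet` only approximately: their marginals are
within `1/n` of `P`, and `I(X;X') < R + 2δ`. By compactness, slightly relaxed constraints lower the
minimum by at most `ε/2`, and remain infeasible if the exponent is infinite
(`exists_slack_ckExponent`). This fixes `δ₀`; the polynomial factors cost the other `ε/2`. -/

theorem empirical_nonneg (x : Fin n → A) (a : A) : 0 ≤ empirical x a := by
  unfold empirical; positivity

theorem empirical_pos_of_apply (hn : 0 < n) (x : Fin n → A) (k : Fin n) :
    0 < empirical x (x k) := by
  classical
  unfold empirical
  have h : 0 < #{j | x j = x k} := card_pos.2 ⟨k, by simp⟩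
  have h' : (0 : ℝ) < #{j | x j = x k} := by exact_mod_cast h
  have hn' : (0 : ℝ) < n := by exact_mod_cast hn
  convert div_pos h' hn'

/-- Grouping positions by letter shows that additive functionals depend on the type alone; this is
how product weights become `exp (n · …)`. -/
theorem sum_apply_eq_mul_sum_empirical [Fintype A] (hn : 0 < n) (x : Fin n → A) (g : A → ℝ) :
    ∑ k, g (x k) = n * ∑ a, empirical x a * g a := by
  classical
  have hn' : (n : ℝ) ≠ 0 := by exact_mod_cast hn.ne'
  rw [← sum_fiberwise (s := univ) (g := x), mul_sum]
  refine sum_congr rfl fun a _ => ?_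
  rw [sum_congr rfl (g := fun _ => g a) (fun k hk => by rw [(mem_filter.1 hk).2])]
  simp only [sum_const, nsmul_eq_mul, empirical]
  field_simp

theorem sum_empirical [Fintype A] (hn : 0 < n) (x : Fin n → A) : ∑ a, empirical x a = 1 := by
  have h := sum_apply_eq_mul_sum_empirical hn x fun _ => 1
  have hn' : (n : ℝ) ≠ 0 := by exact_mod_cast hn.ne'
  simp only [sum_const, card_univ, Fintype.card_fin, nsmul_eq_mul, mul_one] at h
  exact (mul_left_cancel₀ hn' (by linarith)).symm

theorem empirical_mem_stdSimplex [Fintype A] (hn : 0 < n) (x : Fin n → A) :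
    empirical x ∈ stdSimplex ℝ A :=
  ⟨empirical_nonneg x, sum_empirical hn x⟩

-- Types push forward under letterwise maps; all marginal identities for joint types are instances.
open Classical in
theorem empirical_comp [Fintype A] (x : Fin n → A) (f : A → B) (b : B) :
    empirical (fun k => f (x k)) b = ∑ a with f a = b, empirical x a := by
  simp only [empirical, ← sum_div]
  congr 1
  rw [← Nat.cast_sum, card_eq_sum_card_fiberwise (f := x) (t := ({a | f a = b} : Finset A))]
  · congr 1
    refine sum_congr rfl fun a ha => ?_
    congr 1
    ext k
    simp only [mem_filter, mem_univ, true_and] at ha ⊢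
    exact ⟨fun h => h.2, fun h => ⟨by rw [h, ha], h⟩⟩
  · intro k hk
    simpa using hk

theorem marginalFst_jointType [Fintype A] [Fintype B] (x : Fin n → A) (y : Fin n → B) :
    marginalFst (jointType x y) = empirical x := by
  classical
  funext a
  rw [show x = fun k => Prod.fst ((fun k => (x k, y k)) k) from rfl, empirical_comp]
  refine sum_bij (fun b _ => (a, b)) (by simp) (by simp) ?_ (by simp [jointType])
  rintro ⟨a', b⟩ h
  simp only [mem_filter, mem_univ, true_and] at h
  exact ⟨b, mem_univ _, by rw [h]⟩

theorem marginalSnd_jointType [Fintype A] [Fintype B] (x : Fin n → A) (y : Fin n → B) :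
    marginalSnd (jointType x y) = empirical y := by
  classical
  funext b
  rw [show y = fun k => Prod.snd ((fun k => (x k, y k)) k) from rfl, empirical_comp]
  refine sum_bij (fun a _ => (a, b)) (by simp) (by simp) ?_ (by simp [jointType])
  rintro ⟨a, b'⟩ h
  simp only [mem_filter, mem_univ, true_and] at h
  exact ⟨a, mem_univ _, by rw [h]⟩

theorem jointType_swap [Fintype A] [Fintype B] (x : Fin n → A) (y : Fin n → B) :
    (fun c : B × A => jointType x y c.swap) = jointType y x := by
  classical
  funext ⟨b, a⟩
  simp only [jointType, empirical, Prod.swap_prod_mk, Prod.mk.injEq]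
  congr 3
  ext k
  simp [and_comm]

-- Each letter count lies in `{0, …, n}`, so there are polynomially many types.
open Classical in
theorem card_image_empirical_le [Fintype A] (s : Finset (Fin n → A)) :
    #(s.image empirical) ≤ (n + 1) ^ Fintype.card A := by
  have h : s.image empirical ⊆
      (univ : Finset (A → Fin (n + 1))).image fun c a => ((c a : ℕ) : ℝ) / n := by
    intro p hp
    obtain ⟨x, -, rfl⟩ := mem_image.1 hp
    refine mem_image.2 ⟨fun a => ⟨#{k | x k = a}, ?_⟩, mem_univ _, rfl⟩
    exact Nat.lt_succ_of_le ((card_le_univ _).trans (by simp))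
  refine (card_le_card h).trans (card_image_le.trans ?_)
  simp

theorem empirical_comp_perm (x : Fin n → A) (g : Equiv.Perm (Fin n)) :
    empirical (x ∘ g) = empirical x := by
  classical
  funext a
  unfold empirical
  congr 2
  exact card_bij (fun k _ => g k) (by simp) (by simp) fun k hk => ⟨g.symm k, by simpa using hk, by simp⟩

end Types

/-! ### Cardinalities of type classes -/

/-- A weak Stirling bound, by induction from `(m + 1) log (1 + 1/m) ≥ 1`. The factor `m + 1` in
place of `m` admits `m = 0`. -/
theorem factorial_le_mul_exp (m : ℕ) :
    (m.factorial : ℝ) ≤ Real.exp 1 * (m + 1) * Real.exp (m * Real.log m - m) := by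
  rcases Nat.eq_zero_or_pos m with rfl | hm
  · simp
  suffices h : (m.factorial : ℝ) ≤ Real.exp 1 * m * Real.exp (m * Real.log m - m) by
    refine h.trans ?_
    gcongr
    linarith
  induction m, hm using Nat.le_induction with
  | base => simp [← Real.exp_add]
  | succ m hm ih =>
    have hm' : (0 : ℝ) < m := by exact_mod_cast hm
    rw [Nat.factorial_succ]
    push_cast
    calc ((m : ℝ) + 1) * m.factorial
        ≤ (m + 1) * (Real.exp 1 * m * Real.exp (m * Real.log m - m)) := by gcongr
      _ = (m + 1) * Real.exp (1 + Real.log m + (m * Real.log m - m)) := by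
          rw [Real.exp_add, Real.exp_add, Real.exp_log hm']
      _ ≤ (m + 1) * Real.exp (1 + ((m + 1) * Real.log (m + 1) - (m + 1))) := by
          refine mul_le_mul_of_nonneg_left (Real.exp_le_exp.2 ?_) (by positivity)
          have h := Real.one_sub_inv_le_log_of_pos (x := (m + 1) / m) (by positivity)
          rw [Real.log_div (by positivity) (by positivity)] at h
          have h2 : (1 : ℝ) - (((m : ℝ) + 1) / m)⁻¹ = 1 / (m + 1) := by
            rw [inv_div]; field_simp; ring
          rw [h2, div_le_iff₀ (by positivity)] at h
          nlinarith
      _ = _ := by rw [Real.exp_add]; ring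

/-- One term of the exponential series, `n ^ n / n!`, is at most `e ^ n`. -/
theorem exp_mul_log_sub_le_factorial (n : ℕ) :
    Real.exp (n * Real.log n - n) ≤ (n.factorial : ℝ) := by
  rcases Nat.eq_zero_or_pos n with rfl | hn
  · simp
  have hn' : (0 : ℝ) < n := by exact_mod_cast hn
  have h := Real.pow_div_factorial_le_exp n hn'.le n
  rw [div_le_iff₀ (by positivity)] at h
  rw [Real.exp_sub, Real.exp_nat_mul, Real.exp_log hn', div_le_iff₀ (Real.exp_pos _)]
  linarith

/-- Permuting positions preserves the type, and each rearrangement of `x` arises from at most as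
many permutations as the stabilizer of `x` has, a product of factorials. -/
theorem factorial_le_card_typeClass_mul {A : Type*} [Fintype A] [DecidableEq A] {n : ℕ}
    (x : Fin n → A) :
    n.factorial ≤ #(typeClass n (empirical x)) * ∏ a, (#{k | x k = a}).factorial := by
  classical
  have key : #(univ : Finset (Equiv.Perm (Fin n))) ≤
      (∏ a, (#{k | x k = a}).factorial) *
        #((univ : Finset (Equiv.Perm (Fin n))).image fun g : Equiv.Perm (Fin n) => x ∘ ⇑g) := by
    refine card_le_mul_card_image _ _ fun z hz => ?_
    obtain ⟨g₀, -, rfl⟩ := mem_image.1 hz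
    have hc := DomMulAct.stabilizer_card x
    simp only [Fintype.card_subtype] at hc
    rw [← hc]
    refine card_le_card_of_injOn (fun g => g₀⁻¹.trans g) ?_ ?_
    · intro g hg
      simp only [coe_filter, mem_univ, true_and, Set.mem_ofPred_eq] at hg ⊢
      funext k
      have := congrFun hg (g₀⁻¹ k)
      simpa using this
    · intro g _ g' _ h
      ext k
      have := Equiv.congr_fun h (g₀ k)
      simpa using congrArg Fin.val this
  rw [card_univ, Fintype.card_perm, Fintype.card_fin, mul_comm] at key
  refine key.trans ?_
  gcongr
  intro z hz
  obtain ⟨g, -, rfl⟩ := mem_image.1 hz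
  simp [typeClass, empirical_comp_perm]

theorem exp_entropy_le_card_typeClass {A : Type*} [Fintype A] {n : ℕ} (hn : 0 < n)
    (x : Fin n → A) :
    Real.exp (-(n * ∑ a, empirical x a * Real.log (empirical x a))) ≤
      (Real.exp 1 * (n + 1)) ^ Fintype.card A * #(typeClass n (empirical x)) := by
  classical
  have hn' : (0 : ℝ) < n := by exact_mod_cast hn
  set N : A → ℕ := fun a => #{k | x k = a} with hN
  have hemp : ∀ a, empirical x a = N a / n := fun a => by
    simp only [empirical, hN]
  have hle : ∀ a, (N a : ℝ) ≤ n := fun a => by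
    exact_mod_cast (card_le_univ _).trans (by simp)
  have hsum : ∑ a, (N a : ℝ) = n := by
    have := sum_empirical hn x
    simp only [hemp, ← sum_div] at this
    field_simp at this
    exact this
  have hent : (n * ∑ a, empirical x a * Real.log (empirical x a)) =
      ∑ a, N a * Real.log (N a) - n * Real.log n := by
    rw [mul_sum]
    nth_rewrite 2 [← hsum]
    rw [sum_mul, ← sum_sub_distrib]
    refine sum_congr rfl fun a _ => ?_
    rw [hemp]
    rcases eq_or_ne (N a : ℝ) 0 with h | h
    · simp [h]
    · rw [Real.log_div h hn'.ne']
      field_simp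
  have h1 : (n.factorial : ℝ) ≤ #(typeClass n (empirical x)) * ∏ a, ((N a).factorial : ℝ) := by
    exact_mod_cast factorial_le_card_typeClass_mul x
  have h2 : ∏ a, ((N a).factorial : ℝ) ≤ (Real.exp 1 * (n + 1)) ^ Fintype.card A *
      Real.exp (∑ a, N a * Real.log (N a) - n) := by
    calc ∏ a, ((N a).factorial : ℝ)
        ≤ ∏ a, (Real.exp 1 * (n + 1)) * Real.exp (N a * Real.log (N a) - N a) := by
          refine prod_le_prod (fun _ _ => by positivity) fun a _ => ?_
          refine (factorial_le_mul_exp _).trans ?_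
          gcongr
          exact_mod_cast hle a
      _ = _ := by
          rw [prod_mul_distrib, prod_const, ← Real.exp_sum, sum_sub_distrib, hsum, card_univ]
  have h3 := (exp_mul_log_sub_le_factorial n).trans
    (h1.trans (mul_le_mul_of_nonneg_left h2 (Nat.cast_nonneg _)))
  rw [hent]
  have e1 : Real.exp (n * Real.log n - n) =
      Real.exp (-(∑ a, N a * Real.log (N a) - n * Real.log n)) *
        Real.exp (∑ a, N a * Real.log (N a) - n) := by
    rw [← Real.exp_add]; congr 1; ring
  rw [e1] at h3
  refine le_of_mul_le_mul_right (h3.trans_eq ?_)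
    (Real.exp_pos (∑ a, N a * Real.log (N a) - n))
  ring

open Classical in
/-- Total weight, under a nonnegative kernel `w`, of the sequences of a
given conditional type. -/
theorem sum_prod_le_exp {A C : Type*} [Fintype A] [Fintype C] {n : ℕ} (hn : 0 < n)
    (z : Fin n → C) (V : C × A → ℝ) (w : C → A → ℝ) (hw : ∀ c a, 0 ≤ w c a)
    (hV : ∀ c a, w c a = 0 → V (c, a) = 0) :
    ∑ a : Fin n → A with jointType z a = V, ∏ k, w (z k) (a k) ≤
      Real.exp (-(n * ∑ c, ∑ a, V (c, a) * Real.log (V (c, a) / marginalFst V c / w c a))) := by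
  rcases Finset.eq_empty_or_nonempty ({a | jointType z a = V} : Finset (Fin n → A)) with h | h
  · rw [h, sum_empty]; exact (Real.exp_pos _).le
  obtain ⟨a₀, ha₀⟩ := h
  have hV0 : ∀ c, 0 ≤ V c := by
    rw [← (mem_filter.1 ha₀).2]; exact empirical_nonneg _
  have hVle : ∀ c a, V (c, a) ≤ marginalFst V c := fun c a =>
    single_le_sum (f := fun a => V (c, a)) (fun a _ => hV0 _) (mem_univ a)
  -- Change of measure to the conditional law `u` of `V`: on the conditional type class the weights
  -- `w` and `u` differ by a constant factor `exp (-n D)`, and the total `u`-weight is at most 1.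
  set u : C → A → ℝ := fun c a => V (c, a) / marginalFst V c with hu
  have hu0 : ∀ c a, 0 ≤ u c a := fun c a => div_nonneg (hV0 _) ((hV0 _).trans (hVle c a))
  have hone : ∀ a : Fin n → A, jointType z a = V → ∏ k, w (z k) (a k) =
      Real.exp (-(n * ∑ c, ∑ a, V (c, a) * Real.log (u c a / w c a))) *
        ∏ k, u (z k) (a k) := by
    intro a ha
    have hpos : ∀ k, 0 < V (z k, a k) := fun k => by
      rw [← ha]; exact empirical_pos_of_apply hn (fun k => (z k, a k)) k
    have hupos : ∀ k, 0 < u (z k) (a k) := fun k =>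
      div_pos (hpos k) ((hpos k).trans_le (hVle _ _))
    have hwpos : ∀ k, 0 < w (z k) (a k) := fun k =>
      lt_of_le_of_ne (hw _ _) fun h => (hpos k).ne' (hV _ _ h.symm)
    have hs := sum_apply_eq_mul_sum_empirical hn (fun k => (z k, a k))
      (fun c => Real.log (u c.1 c.2 / w c.1 c.2))
    rw [show empirical (fun k => (z k, a k)) = V from ha, Fintype.sum_prod_type] at hs
    simp only at hs
    rw [← hs, ← sum_neg_distrib, Real.exp_sum, ← prod_mul_distrib]
    refine prod_congr rfl fun k _ => ?_
    rw [← Real.log_inv, Real.exp_log (inv_pos.2 (div_pos (hupos k) (hwpos k))), inv_div]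
    field_simp [(hupos k).ne']
  rw [sum_congr rfl fun a ha => hone a (mem_filter.1 ha).2, ← mul_sum]
  refine mul_le_of_le_one_right (Real.exp_pos _).le ?_
  calc ∑ a : Fin n → A with jointType z a = V, ∏ k, u (z k) (a k)
      ≤ ∑ a : Fin n → A, ∏ k, u (z k) (a k) :=
        sum_le_sum_of_subset_of_nonneg (filter_subset _ _)
          fun a _ _ => prod_nonneg fun k _ => hu0 _ _
    _ = ∏ k, ∑ b, u (z k) b := by
        rw [prod_univ_sum, Fintype.piFinset_univ]
    _ ≤ 1 := prod_le_one (fun k _ => sum_nonneg fun b _ => hu0 _ _) fun k _ => by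
        simp only [hu, ← sum_div]
        -- Only `≤ 1` is needed, so a vanishing marginal, where the quotient is `0 / 0 = 0`, does no
        -- harm.
        exact div_self_le_one (marginalFst V (z k))

/-- The form `H(A) - H(A|C)`: the first entropy measures a type class, the second a conditional type
class. -/
theorem mutualInfo_eq_sum_sub {A C : Type*} [Fintype A] [Fintype C] {Q : A × C → ℝ}
    (hQ : ∀ c, 0 ≤ Q c) :
    mutualInfo Q = ∑ c, ∑ a, Q (a, c) * Real.log (Q (a, c) / marginalSnd Q c) -
      ∑ a, marginalFst Q a * Real.log (marginalFst Q a) := by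
  have h : ∑ a, marginalFst Q a * Real.log (marginalFst Q a) =
      ∑ c, ∑ a, Q (a, c) * Real.log (marginalFst Q a) := by
    rw [sum_comm]
    exact sum_congr rfl fun a _ => by rw [← sum_mul]; rfl
  rw [h, ← sum_sub_distrib, mutualInfo, Fintype.sum_prod_type, sum_comm]
  refine sum_congr rfl fun c _ => ?_
  rw [← sum_sub_distrib]
  refine sum_congr rfl fun a _ => ?_
  rcases (hQ (a, c)).eq_or_lt with h0 | h0
  · simp [← h0]
  have h1 : 0 < marginalFst Q a := h0.trans_le
    (single_le_sum (f := fun c => Q (a, c)) (fun _ _ => hQ _) (mem_univ c))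
  have h2 : 0 < marginalSnd Q c := h0.trans_le
    (single_le_sum (f := fun a => Q (a, c)) (fun _ _ => hQ _) (mem_univ a))
  rw [Real.log_div h0.ne' (by positivity), Real.log_div h0.ne' h2.ne',
    Real.log_mul h1.ne' h2.ne']
  ring

open Classical in
/-- The sequences that have joint type `Q` with a given `z` are a fraction of about
`exp (-n I(Q))` of their type class. -/
theorem card_jointType_eq_le {A C : Type*} [Fintype A] [Fintype C] {n : ℕ} (hn : 0 < n)
    (z : Fin n → C) (Q : A × C → ℝ) :
    (#{a : Fin n → A | jointType a z = Q} : ℝ) ≤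
      (Real.exp 1 * (n + 1)) ^ Fintype.card A * #(typeClass n (marginalFst Q)) *
        Real.exp (-(n * mutualInfo Q)) := by
  rcases Finset.eq_empty_or_nonempty ({a | jointType a z = Q} : Finset (Fin n → A)) with h | h
  · rw [h, card_empty, Nat.cast_zero]; positivity
  obtain ⟨a₀, ha₀⟩ := h
  have ha₀' : jointType a₀ z = Q := (mem_filter.1 ha₀).2
  have hQ : ∀ c, 0 ≤ Q c := by rw [← ha₀']; exact empirical_nonneg _
  set V : C × A → ℝ := fun c => Q c.swap with hVdef
  have hset : ∀ a : Fin n → A, jointType a z = Q ↔ jointType z a = V := fun a => by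
    rw [← jointType_swap a z, hVdef]
    refine ⟨fun h => by rw [h], fun h => funext fun c => ?_⟩
    simpa using congrFun h c.swap
  -- With the constant kernel 1, the weighted sum is a cardinality.
  have h1 := sum_prod_le_exp hn z V (fun _ _ => 1) (fun _ _ => zero_le_one)
    (fun _ _ h => absurd h one_ne_zero)
  simp only [prod_const_one, sum_const, nsmul_eq_mul, mul_one, ← hset] at h1
  have h2 := exp_entropy_le_card_typeClass hn a₀
  have hm : marginalFst Q = empirical a₀ := by rw [← ha₀', marginalFst_jointType]
  rw [← hm] at h2
  refine h1.trans ?_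
  refine le_trans (le_of_eq ?_) (mul_le_mul_of_nonneg_right h2 (Real.exp_pos _).le)
  rw [← Real.exp_add, mutualInfo_eq_sum_sub hQ]
  congr 1
  have hV : marginalFst V = marginalSnd Q := rfl
  rw [hV]
  simp only [hVdef, Prod.swap_prod_mk, div_one]
  ring

theorem eventually_mul_pow_le_exp (C : ℝ) (k : ℕ) {η : ℝ} (hη : 0 < η) :
    ∃ N : ℕ, ∀ n : ℕ, N ≤ n → C * (Real.exp 1 * (n + 1)) ^ k ≤ Real.exp (n * η) := by
  -- The estimate is applied at `n + 1`, whence the factor `exp η`; the `+ 1` keeps the constant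
  -- positive.
  have h := (isLittleO_pow_exp_pos_mul_atTop k hη).bound
    (c := (|C| * Real.exp 1 ^ k * Real.exp η + 1)⁻¹) (by positivity)
  have h2 := (tendsto_natCast_atTop_atTop (R := ℝ)).comp (Filter.tendsto_add_atTop_nat 1)
  obtain ⟨N, hN⟩ := Filter.eventually_atTop.1 (h2.eventually h)
  refine ⟨N, fun n hn => ?_⟩
  have h3 := hN n hn
  simp only [Function.comp, Nat.cast_add, Nat.cast_one, norm_pow, Real.norm_eq_abs,
    Real.abs_exp] at h3
  rw [abs_of_nonneg (by positivity : (0 : ℝ) ≤ (n : ℝ) + 1), inv_mul_eq_div,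
    le_div_iff₀ (by positivity)] at h3
  have h4 : Real.exp (η * (n + 1)) = Real.exp (n * η) * Real.exp η := by
    rw [← Real.exp_add]; ring_nf
  rw [h4] at h3
  refine le_of_mul_le_mul_right (le_trans ?_ h3) (Real.exp_pos η)
  rw [mul_pow]
  have h5 : C * (Real.exp 1 ^ k * ((n : ℝ) + 1) ^ k) * Real.exp η ≤
      |C| * (Real.exp 1 ^ k * ((n : ℝ) + 1) ^ k) * Real.exp η := by
    gcongr; exact le_abs_self C
  have h6 : (0 : ℝ) ≤ ((n : ℝ) + 1) ^ k := by positivity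
  nlinarith

end RGV

namespace RGV

open Finset

/-! ### Continuity of the information quantities -/

section Continuity

theorem continuous_marginalFst {A B : Type*} [Fintype B] : Continuous (marginalFst : (A × B → ℝ) → A → ℝ) := by
  unfold marginalFst; fun_prop

theorem continuous_marginalSnd {A B : Type*} [Fintype A] : Continuous (marginalSnd : (A × B → ℝ) → B → ℝ) := by
  unfold marginalSnd; fun_prop

variable {A B : Type*} [Fintype A] [Fintype B]

theorem continuous_sum_mul_log : Continuous fun p : A → ℝ => ∑ a, p a * Real.log (p a) :=
  continuous_finsetSum _ fun a _ => Real.continuous_mul_log.comp (continuous_apply a)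

theorem sum_mul_log_div_marginalSnd {Q : A × B → ℝ} (hQ : ∀ c, 0 ≤ Q c) :
    ∑ b, ∑ a, Q (a, b) * Real.log (Q (a, b) / marginalSnd Q b) =
      ∑ c, Q c * Real.log (Q c) - ∑ b, marginalSnd Q b * Real.log (marginalSnd Q b) := by
  rw [Fintype.sum_prod_type_right, ← sum_sub_distrib]
  refine sum_congr rfl fun b _ => ?_
  nth_rewrite 2 [marginalSnd]
  rw [sum_mul, ← sum_sub_distrib]
  refine sum_congr rfl fun a _ => ?_
  rcases (hQ (a, b)).eq_or_lt with h0 | h0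
  · simp [← h0]
  have h2 : 0 < marginalSnd Q b := h0.trans_le
    (single_le_sum (f := fun a => Q (a, b)) (fun _ _ => hQ _) (mem_univ a))
  rw [Real.log_div h0.ne' h2.ne']
  ring

/-- In this form continuity is visible, since `t log t` is continuous at 0 while the quotient inside
the logarithm is not. -/
theorem mutualInfo_eq_entropies {Q : A × B → ℝ} (hQ : ∀ c, 0 ≤ Q c) :
    mutualInfo Q = ∑ c, Q c * Real.log (Q c) -
      ∑ b, marginalSnd Q b * Real.log (marginalSnd Q b) -
      ∑ a, marginalFst Q a * Real.log (marginalFst Q a) := by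
  rw [mutualInfo_eq_sum_sub hQ, sum_mul_log_div_marginalSnd hQ]

theorem continuousOn_mutualInfo :
    ContinuousOn (mutualInfo : (A × B → ℝ) → ℝ) (stdSimplex ℝ (A × B)) := by
  refine ContinuousOn.congr (Continuous.continuousOn ?_)
    fun Q hQ => mutualInfo_eq_entropies hQ.1
  exact (continuous_sum_mul_log.sub (continuous_sum_mul_log.comp continuous_marginalSnd)).sub
    (continuous_sum_mul_log.comp continuous_marginalFst)

theorem mutualInfo_swap (Q : A × B → ℝ) :
    mutualInfo (fun c : B × A => Q c.swap) = mutualInfo Q := by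
  unfold mutualInfo
  refine Fintype.sum_equiv (Equiv.prodComm B A) _ _ fun c => ?_
  rw [mul_comm (marginalFst _ _)]
  rfl

theorem isDistanceFunction_negInfo : IsDistanceFunction (negInfo : (A × A → ℝ) → ℝ) := by
  have hc : ContinuousOn (negInfo : (A × A → ℝ) → ℝ) (stdSimplex ℝ (A × A)) :=
    continuousOn_mutualInfo.neg
  refine ⟨hc, ?_, fun Q _ => ?_⟩
  · obtain ⟨B, hB⟩ := (isCompact_stdSimplex ℝ (A × A)).exists_bound_of_continuousOn hc
    exact ⟨B, hB⟩
  · simp only [negInfo, mutualInfo_swap]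

theorem rateCondition_negInfo (R : ℝ) (P : A → ℝ) (δ : ℝ) :
    RateCondition R P negInfo (-(R + 2 * δ)) δ := by
  unfold RateCondition
  have h : ((R + 2 * δ : ℝ) : EReal) ≤
      ⨅ Q ∈ {Q : A × A → ℝ | Q ∈ stdSimplex ℝ (A × A) ∧ negInfo Q ≤ -(R + 2 * δ) ∧
        marginalFst Q = P ∧ marginalSnd Q = P}, (mutualInfo Q : EReal) := by
    refine le_iInf₂ fun Q hQ => EReal.coe_le_coe_iff.2 ?_
    have := hQ.2.1
    simp only [negInfo] at this
    linarith
  calc (R : EReal) = ((R + 2 * δ : ℝ) : EReal) - ((2 * δ : ℝ) : EReal) := by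
        rw [← EReal.coe_sub]; congr 1; ring
    _ ≤ _ := EReal.sub_le_sub h le_rfl

end Continuity

/-! ### Perturbation of the Csiszár-Körner exponent -/

section Exponent

theorem continuous_margXX {X Y : Type*} [Fintype Y] : Continuous (margXX : (X × X × Y → ℝ) → X × X → ℝ) := by
  unfold margXX; fun_prop

theorem continuous_margXY {X Y : Type*} [Fintype X] : Continuous (margXY : (X × X × Y → ℝ) → X × Y → ℝ) := by
  unfold margXY; fun_prop

theorem continuous_margX'Y {X Y : Type*} [Fintype X] : Continuous (margX'Y : (X × X × Y → ℝ) → X × Y → ℝ) := by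
  unfold margX'Y; fun_prop

variable {X Y : Type*} [Fintype X] [Fintype Y]

theorem margXX_mem_stdSimplex {V : X × X × Y → ℝ} (hV : V ∈ stdSimplex ℝ (X × X × Y)) :
    margXX V ∈ stdSimplex ℝ (X × X) :=
  ⟨fun _ => sum_nonneg fun _ _ => hV.1 _, by
    rw [← hV.2]; simp only [Fintype.sum_prod_type]; rfl⟩

theorem margXY_mem_stdSimplex {V : X × X × Y → ℝ} (hV : V ∈ stdSimplex ℝ (X × X × Y)) :
    margXY V ∈ stdSimplex ℝ (X × Y) :=
  ⟨fun _ => sum_nonneg fun _ _ => hV.1 _, by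
    rw [← hV.2]; simp only [Fintype.sum_prod_type]
    exact sum_congr rfl fun x _ => sum_comm⟩

theorem margX'Y_mem_stdSimplex {V : X × X × Y → ℝ} (hV : V ∈ stdSimplex ℝ (X × X × Y)) :
    margX'Y V ∈ stdSimplex ℝ (X × Y) :=
  ⟨fun _ => sum_nonneg fun _ _ => hV.1 _, by
    rw [← hV.2]; simp only [Fintype.sum_prod_type]
    rw [sum_comm' (t' := univ) (s' := fun _ => univ) (by simp)]
    exact sum_comm.trans ((sum_congr rfl fun x _ => sum_comm).trans sum_comm)⟩

/-- The joint distribution of `X'` and the pair `(X, Y)`. -/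
def pairX'XY (V : X × X × Y → ℝ) : X × (X × Y) → ℝ :=
  fun c => V (c.2.1, c.1, c.2.2)

theorem pairX'XY_mem_stdSimplex {V : X × X × Y → ℝ} (hV : V ∈ stdSimplex ℝ (X × X × Y)) :
    pairX'XY V ∈ stdSimplex ℝ (X × (X × Y)) :=
  ⟨fun _ => hV.1 _, by
    rw [← hV.2]; simp only [Fintype.sum_prod_type, pairX'XY]; exact sum_comm⟩

theorem continuousOn_infoX'YX :
    ContinuousOn (infoX'YX : (X × X × Y → ℝ) → ℝ) (stdSimplex ℝ (X × X × Y)) :=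
  continuousOn_mutualInfo.comp
    (f := pairX'XY) (by unfold pairX'XY; fun_prop) fun _ hV => pairX'XY_mem_stdSimplex hV

/-- The conditional divergence as a real number, for `U` absolutely continuous with respect
to `W`. -/
noncomputable def condDivReal (U : X × Y → ℝ) (W : X → Y → ℝ) : ℝ :=
  ∑ x, ∑ y, U (x, y) * Real.log (U (x, y) / marginalFst U x / W x y)

theorem condDiv_eq_coe {U : X × Y → ℝ} {W : X → Y → ℝ} (h : ∀ x y, W x y = 0 → U (x, y) = 0) :
    condDiv U W = (condDivReal U W : EReal) := by
  rw [condDiv, if_pos h]; rfl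

/-- The joint distributions absolutely continuous with respect to `W`. -/
def acSet (W : X → Y → ℝ) : Set (X × Y → ℝ) :=
  {U | U ∈ stdSimplex ℝ (X × Y) ∧ ∀ x y, W x y = 0 → U (x, y) = 0}

theorem isClosed_acSet (W : X → Y → ℝ) : IsClosed (acSet W) := by
  refine (isClosed_stdSimplex ℝ (X × Y)).inter ?_
  have h : {U : X × Y → ℝ | ∀ x y, W x y = 0 → U (x, y) = 0} =
      ⋂ (x) (y) (_ : W x y = 0), {U | U (x, y) = 0} := by ext; simp
  change IsClosed {U : X × Y → ℝ | ∀ x y, W x y = 0 → U (x, y) = 0}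
  rw [h]
  exact isClosed_iInter fun x => isClosed_iInter fun y => isClosed_iInter fun _ =>
    isClosed_eq (continuous_apply _) continuous_const

/-- On `acSet W` the divergence is a difference of entropies plus a linear form with coefficients
`log W`. Pairs with `W = 0` carry no mass there, so they contribute nothing to either side. -/
theorem continuousOn_condDivReal (W : X → Y → ℝ) :
    ContinuousOn (fun U => condDivReal U W) (acSet W) := by
  have hcont : Continuous fun U : X × Y → ℝ => ∑ c, U c * Real.log (U c) -
      ∑ x, marginalFst U x * Real.log (marginalFst U x) -
      ∑ x, ∑ y, U (x, y) * Real.log (W x y) := by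
    refine (continuous_sum_mul_log.sub
      (continuous_sum_mul_log.comp continuous_marginalFst)).sub ?_
    fun_prop
  refine hcont.continuousOn.congr fun U hU => ?_
  simp only [condDivReal]
  rw [Fintype.sum_prod_type, ← sum_sub_distrib, ← sum_sub_distrib]
  refine sum_congr rfl fun x _ => ?_
  nth_rewrite 2 [marginalFst]
  rw [sum_mul, ← sum_sub_distrib, ← sum_sub_distrib]
  refine sum_congr rfl fun y _ => ?_
  rcases (hU.1.1 (x, y)).eq_or_lt with h0 | h0
  · simp [← h0]
  have h2 : 0 < marginalFst U x := h0.trans_le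
    (single_le_sum (f := fun y => U (x, y)) (fun _ _ => hU.1.1 _) (mem_univ y))
  have h3 : W x y ≠ 0 := fun h => h0.ne' (hU.2 x y h)
  rw [Real.log_div (by positivity) h3, Real.log_div h0.ne' h2.ne']
  ring

/-- The objective of the Csiszár-Körner exponent as a real number. -/
noncomputable def ckObjective (R : ℝ) (W : X → Y → ℝ) (V : X × X × Y → ℝ) : ℝ :=
  condDivReal (margXY V) W + max (infoX'YX V - R) 0

/-- The joint distributions of finite divergence for which `q` favours `X'`. -/
def confusionSet (q : (X × Y → ℝ) → ℝ) (W : X → Y → ℝ) : Set (X × X × Y → ℝ) :=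
  {V | V ∈ stdSimplex ℝ (X × X × Y) ∧ margXY V ∈ acSet W ∧ q (margXY V) ≤ q (margX'Y V)}

theorem isCompact_confusionSet {q : (X × Y → ℝ) → ℝ}
    (hq : ContinuousOn q (stdSimplex ℝ (X × Y))) (W : X → Y → ℝ) :
    IsCompact (confusionSet q W) := by
  have h1 : IsCompact {V | V ∈ stdSimplex ℝ (X × X × Y) ∧ q (margXY V) ≤ q (margX'Y V)} := by
    refine (isCompact_stdSimplex ℝ _).of_isClosed_subset ?_ fun V hV => hV.1
    exact (isClosed_stdSimplex ℝ _).isClosed_le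
      (hq.comp continuous_margXY.continuousOn fun V hV => margXY_mem_stdSimplex hV)
      (hq.comp continuous_margX'Y.continuousOn fun V hV => margX'Y_mem_stdSimplex hV)
  have h2 := h1.inter_right ((isClosed_acSet W).preimage continuous_margXY)
  convert h2 using 1
  ext V
  exact ⟨fun h => ⟨⟨h.1, h.2.2⟩, h.2.1⟩, fun h => ⟨h.1.1, h.2, h.1.2⟩⟩

theorem continuousOn_ckObjective (R : ℝ) (q : (X × Y → ℝ) → ℝ) (W : X → Y → ℝ) :
    ContinuousOn (ckObjective R W) (confusionSet q W) := by
  refine ((continuousOn_condDivReal W).comp continuous_margXY.continuousOn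
    fun V hV => hV.2.1).add ?_
  refine ContinuousOn.sup ?_ continuousOn_const
  exact (continuousOn_infoX'YX.mono fun V hV => hV.1).sub continuousOn_const

theorem ckExponent_le_ckObjective {q : (X × Y → ℝ) → ℝ} {R : ℝ} {P : X → ℝ} {W : X → Y → ℝ}
    {V : X × X × Y → ℝ} (hV : V ∈ confusionSet q W) (hV' : V ∈ ckSet q R P) :
    ckExponent q R P W ≤ (ckObjective R W V : EReal) := by
  refine (iInf₂_le V hV').trans_eq ?_
  rw [condDiv_eq_coe hV.2.1.2, ← EReal.coe_add]
  rfl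

/-- Joint distributions in a compact set that has no member with both marginals `P` and
`I(X; X') ≤ R` violate these constraints by a fixed amount. -/
theorem exists_slack_of_isCompact {K : Set (X × X × Y → ℝ)} (hK : IsCompact K)
    (hKs : K ⊆ stdSimplex ℝ (X × X × Y)) (R : ℝ) (P : X → ℝ)
    (h : ∀ V ∈ K, marginalFst (margXX V) = P → marginalSnd (margXX V) = P →
      ¬ mutualInfo (margXX V) ≤ R) :
    ∃ η > 0, ∀ V ∈ K, (∀ a, |marginalFst (margXX V) a - P a| < η) →
      (∀ a, |marginalSnd (margXX V) a - P a| < η) → R + η ≤ mutualInfo (margXX V) := by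
  rcases K.eq_empty_or_nonempty with rfl | hne
  · exact ⟨1, one_pos, by simp⟩
  -- The largest violation of the three constraints. It is continuous and positive on `K`, so its
  -- minimum serves as `η`.
  set g : (X × X × Y → ℝ) → ℝ := fun V =>
    max (max ‖marginalFst (margXX V) - P‖ ‖marginalSnd (margXX V) - P‖)
      (mutualInfo (margXX V) - R)
  have hg : ContinuousOn g K := by
    refine ContinuousOn.sup (ContinuousOn.sup ?_ ?_) ?_
    · exact ((continuous_marginalFst.comp continuous_margXX).sub
        continuous_const).norm.continuousOn
    · exact ((continuous_marginalSnd.comp continuous_margXX).sub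
        continuous_const).norm.continuousOn
    · exact (continuousOn_mutualInfo.comp continuous_margXX.continuousOn
        fun V hV => margXX_mem_stdSimplex (hKs hV)).sub continuousOn_const
  obtain ⟨V₀, hV₀, hmin⟩ := hK.exists_isMinOn hne hg
  have hpos : 0 < g V₀ := by
    by_contra hle
    rw [not_lt, max_le_iff, max_le_iff, norm_le_zero_iff, norm_le_zero_iff, sub_eq_zero,
      sub_eq_zero, sub_nonpos] at hle
    exact h V₀ hV₀ hle.1.1 hle.1.2 hle.2
  refine ⟨g V₀, hpos, fun V hV h1 h2 => ?_⟩
  have hle : g V₀ ≤ g V := hmin hV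
  have n1 : ‖marginalFst (margXX V) - P‖ < g V₀ := (pi_norm_lt_iff hpos).2 h1
  have n2 : ‖marginalSnd (margXX V) - P‖ < g V₀ := (pi_norm_lt_iff hpos).2 h2
  rcases le_max_iff.1 hle with h3 | h3
  · exact absurd h3 (not_le.2 (max_lt n1 n2))
  · linarith

/-- Slightly relaxed constraints still force the objective above any `e < E_q(R, P, W)`. -/
theorem exists_slack_of_lt_ckExponent {q : (X × Y → ℝ) → ℝ}
    (hq : ContinuousOn q (stdSimplex ℝ (X × Y))) {R : ℝ} {P : X → ℝ} {W : X → Y → ℝ} {e : ℝ}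
    (he : (e : EReal) < ckExponent q R P W) :
    ∃ η > 0, ∀ V ∈ confusionSet q W, (∀ a, |marginalFst (margXX V) a - P a| < η) →
      (∀ a, |marginalSnd (margXX V) a - P a| < η) → mutualInfo (margXX V) < R + η →
      e < ckObjective R W V := by
  -- A feasible point of this sublevel set would force the exponent down to `e`, so the compactness
  -- argument applies to it.
  have hK : IsCompact {V | V ∈ confusionSet q W ∧ ckObjective R W V ≤ e} :=
    (isCompact_confusionSet hq W).of_isClosed_subset
      ((isCompact_confusionSet hq W).isClosed.isClosed_le
        (continuousOn_ckObjective R q W) continuousOn_const) fun V hV => hV.1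
  obtain ⟨η, hη, h⟩ := exists_slack_of_isCompact hK (fun V hV => hV.1.1) R P
    fun V hV h1 h2 h3 => by
      have := (ckExponent_le_ckObjective hV.1 ⟨hV.1.1, h1, h2, hV.1.2.2, h3⟩).trans
        (EReal.coe_le_coe_iff.2 hV.2)
      exact absurd he (not_lt.2 this)
  refine ⟨η, hη, fun V hV h1 h2 h3 => ?_⟩
  by_contra hle
  exact absurd (h V ⟨hV, not_lt.1 hle⟩ h1 h2) (not_le.2 h3)

/-- If the exponent is infinite, slightly relaxed constraints are still infeasible. -/
theorem exists_slack_of_ckExponent_eq_top {q : (X × Y → ℝ) → ℝ}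
    (hq : ContinuousOn q (stdSimplex ℝ (X × Y))) {R : ℝ} {P : X → ℝ} {W : X → Y → ℝ}
    (he : ckExponent q R P W = ⊤) :
    ∃ η > 0, ∀ V ∈ confusionSet q W, (∀ a, |marginalFst (margXX V) a - P a| < η) →
      (∀ a, |marginalSnd (margXX V) a - P a| < η) → R + η ≤ mutualInfo (margXX V) :=
  exists_slack_of_isCompact (isCompact_confusionSet hq W) (fun V hV => hV.1) R P
    fun V hV h1 h2 h3 => by
      have := ckExponent_le_ckObjective hV ⟨hV.1, h1, h2, hV.2.2, h3⟩
      rw [he] at this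
      exact absurd this (not_le.2 (EReal.coe_lt_top _))

/-- Joins the finite and the infinite case. In the latter the hypotheses on `V` contradict each
other, so the inequality holds vacuously. -/
theorem exists_slack_ckExponent {q : (X × Y → ℝ) → ℝ}
    (hq : ContinuousOn q (stdSimplex ℝ (X × Y))) (R : ℝ) (P : X → ℝ) (W : X → Y → ℝ) {ε : ℝ}
    (hε : 0 < ε) :
    ∃ η > 0, ∀ V ∈ confusionSet q W, (∀ a, |marginalFst (margXX V) a - P a| < η) →
      (∀ a, |marginalSnd (margXX V) a - P a| < η) → mutualInfo (margXX V) < R + η →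
      ckExponent q R P W ≤ ((ckObjective R W V + ε : ℝ) : EReal) := by
  induction h : ckExponent q R P W using EReal.rec with
  | bot => exact ⟨1, one_pos, fun _ _ _ _ _ => bot_le⟩
  | coe r =>
    obtain ⟨η, hη, hs⟩ := exists_slack_of_lt_ckExponent hq (R := R) (P := P) (W := W)
      (e := r - ε) (by rw [h]; exact EReal.coe_lt_coe_iff.2 (by linarith))
    exact ⟨η, hη, fun V hV h1 h2 h3 => EReal.coe_le_coe_iff.2 (by linarith [hs V hV h1 h2 h3])⟩
  | top =>
    obtain ⟨η, hη, hs⟩ := exists_slack_of_ckExponent_eq_top hq h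
    exact ⟨η, hη, fun V hV h1 h2 h3 => absurd h3 (not_lt.2 (hs V hV h1 h2))⟩

end Exponent

end RGV

namespace RGV

open Finset

/-! ### The law of the recursive random codebook -/

section Codebook

variable {X : Type*} [Fintype X] {n : ℕ} {Pn : X → ℝ} {d : (X × X → ℝ) → ℝ} {Δ : ℝ}

theorem codebookProb_nonneg {M : ℕ} (c : Fin M → Fin n → X) : 0 ≤ codebookProb Pn d Δ c := by
  unfold codebookProb
  refine prod_nonneg fun i _ => ?_
  split_ifs <;> positivity

theorem mem_admissible_of_codebookProb_ne_zero {M : ℕ} {c : Fin M → Fin n → X}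
    (h : codebookProb Pn d Δ c ≠ 0) (i : Fin M) : c i ∈ admissible Pn d Δ c i := by
  by_contra hi
  exact h (prod_eq_zero (mem_univ i) (if_neg hi))

theorem mem_typeClass_of_codebookProb_ne_zero {M : ℕ} {c : Fin M → Fin n → X}
    (h : codebookProb Pn d Δ c ≠ 0) (i : Fin M) : c i ∈ typeClass n Pn :=
  (mem_filter.1 (mem_admissible_of_codebookProb_ne_zero h i)).1

variable (Pn d Δ) in
open Classical in
/-- The sequences that may follow the codewords of `c`. -/
noncomputable def nextAdmissible {M : ℕ} (c : Fin M → Fin n → X) : Finset (Fin n → X) :=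
  {x ∈ typeClass n Pn | ∀ j, Δ < d (jointType x (c j))}

theorem admissible_snoc_last {M : ℕ} (c : Fin M → Fin n → X) (a : Fin n → X) :
    admissible Pn d Δ (Fin.snoc c a : Fin (M + 1) → Fin n → X) (Fin.last M) =
      nextAdmissible Pn d Δ c := by
  classical
  ext x
  simp only [admissible, nextAdmissible, mem_filter, and_congr_right_iff]
  refine fun _ => ⟨fun h j => ?_, fun h j hj => ?_⟩
  · simpa using h j.castSucc (Fin.castSucc_lt_last j)
  · obtain ⟨j, rfl⟩ := Fin.exists_castSucc_eq.2 hj.ne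
    simpa using h j

theorem admissible_snoc_castSucc {M : ℕ} (c : Fin M → Fin n → X) (a : Fin n → X) (i : Fin M) :
    admissible Pn d Δ (Fin.snoc c a : Fin (M + 1) → Fin n → X) i.castSucc =
      admissible Pn d Δ c i := by
  classical
  ext x
  simp only [admissible, mem_filter, and_congr_right_iff]
  refine fun _ => ⟨fun h j hj => ?_, fun h j hj => ?_⟩
  · simpa using h j.castSucc (Fin.castSucc_lt_castSucc_iff.2 hj)
  · obtain ⟨j, rfl⟩ := Fin.exists_castSucc_eq.2 (hj.trans (Fin.castSucc_lt_last i)).ne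
    simpa using h j (Fin.castSucc_lt_castSucc_iff.1 hj)

variable (Pn d Δ) in
open Classical in
/-- The conditional probability that `a` is drawn after the codewords of `c`. -/
noncomputable def nextProb {M : ℕ} (c : Fin M → Fin n → X) (a : Fin n → X) : ℝ :=
  if a ∈ nextAdmissible Pn d Δ c then 1 / (#(nextAdmissible Pn d Δ c) : ℝ) else 0

/-- The chain rule; it holds because admissibility of a codeword depends on the earlier ones only.
-/
theorem codebookProb_snoc {M : ℕ} (c : Fin M → Fin n → X) (a : Fin n → X) :
    codebookProb Pn d Δ (Fin.snoc c a : Fin (M + 1) → Fin n → X) =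
      codebookProb Pn d Δ c * nextProb Pn d Δ c a := by
  classical
  simp only [codebookProb, Fin.prod_univ_castSucc, nextProb]
  refine congrArg₂ (· * ·) (prod_congr rfl fun i _ => if_congr ?_ ?_ rfl) (if_congr ?_ ?_ rfl)
  · rw [admissible_snoc_castSucc, Fin.snoc_castSucc]
  · rw [admissible_snoc_castSucc]
  · rw [admissible_snoc_last, Fin.snoc_last]
  · rw [admissible_snoc_last]

theorem sum_snoc {β : Type*} [Fintype β] {M : ℕ} (f : (Fin (M + 1) → β) → ℝ) :
    ∑ c, f c = ∑ c : Fin M → β, ∑ a, f (Fin.snoc c a : Fin (M + 1) → β) := by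
  rw [← (Fin.snocEquiv fun _ => β).sum_comp, Fintype.sum_prod_type_right]
  rfl

open Classical in
variable (Pn d Δ) in
/-- Balls of radius `Δ` around `K` codewords cover at most half of the type class. -/
def HalfCover (n K : ℕ) : Prop :=
  ∀ x ∈ typeClass n Pn,
    2 * ((K : ℝ) * #{z ∈ typeClass n Pn | d (jointType z x) ≤ Δ}) ≤ #(typeClass n Pn)

/-- A sequence of the type class that may not come next lies in the ball of some earlier codeword,
and these balls fill at most half of the class. -/
theorem HalfCover.card_le {K M : ℕ} (h : HalfCover Pn d Δ n K) (hM : M ≤ K)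
    (c : Fin M → Fin n → X) (hc : ∀ i, c i ∈ typeClass n Pn) :
    (#(typeClass n Pn) : ℝ) ≤ 2 * #(nextAdmissible Pn d Δ c) := by
  classical
  set T := typeClass n Pn
  have hsub : T ⊆ nextAdmissible Pn d Δ c ∪
      univ.biUnion fun i => {z ∈ T | d (jointType z (c i)) ≤ Δ} := by
    intro x hx
    by_cases hx' : ∀ j, Δ < d (jointType x (c j))
    · exact mem_union_left _ (mem_filter.2 ⟨hx, hx'⟩)
    · push Not at hx'
      obtain ⟨j, hj⟩ := hx'
      exact mem_union_right _ (mem_biUnion.2 ⟨j, mem_univ _, mem_filter.2 ⟨hx, hj⟩⟩)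
  have h1 : (#T : ℝ) ≤ #(nextAdmissible Pn d Δ c) +
      ∑ i, (#{z ∈ T | d (jointType z (c i)) ≤ Δ} : ℝ) := by
    exact_mod_cast (card_le_card hsub).trans ((card_union_le _ _).trans
      (Nat.add_le_add_left card_biUnion_le _))
  have h2 : 2 * ∑ i, (#{z ∈ T | d (jointType z (c i)) ≤ Δ} : ℝ) ≤ #T := by
    rcases Nat.eq_zero_or_pos K with rfl | hK
    · obtain rfl : M = 0 := by omega
      simp
    have hK' : (0 : ℝ) < K := by exact_mod_cast hK
    have hb : ∀ i, (#{z ∈ T | d (jointType z (c i)) ≤ Δ} : ℝ) ≤ #T / (2 * K) := fun i => by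
      rw [le_div_iff₀ (by positivity)]
      linarith [h (c i) (hc i)]
    calc 2 * ∑ i, (#{z ∈ T | d (jointType z (c i)) ≤ Δ} : ℝ)
        ≤ 2 * ∑ _i : Fin M, (#T : ℝ) / (2 * K) := by gcongr; exact hb _
      _ = M / K * #T := by
          rw [sum_const, card_univ, Fintype.card_fin, nsmul_eq_mul]
          field_simp
      _ ≤ 1 * #T := by
          gcongr
          rw [div_le_one hK']
          exact_mod_cast hM
      _ = #T := one_mul _
  linarith

section

variable {K M : ℕ} (h : HalfCover Pn d Δ n K) (hT : (typeClass n Pn).Nonempty)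

include h hT

theorem HalfCover.card_pos (hM : M ≤ K) {c : Fin M → Fin n → X}
    (hc : codebookProb Pn d Δ c ≠ 0) : (0 : ℝ) < #(nextAdmissible Pn d Δ c) := by
  have h1 := h.card_le hM c (mem_typeClass_of_codebookProb_ne_zero hc)
  have h2 : (0 : ℝ) < #(typeClass n Pn) := by exact_mod_cast hT.card_pos
  linarith

theorem HalfCover.sum_nextProb (hM : M ≤ K) {c : Fin M → Fin n → X}
    (hc : codebookProb Pn d Δ c ≠ 0) : ∑ a, nextProb Pn d Δ c a = 1 := by
  classical
  have := (h.card_pos hT hM hc).ne'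
  simp only [nextProb]
  rw [sum_ite_mem, univ_inter, sum_const, nsmul_eq_mul]
  field_simp

theorem HalfCover.nextProb_le (hM : M ≤ K) {c : Fin M → Fin n → X}
    (hc : codebookProb Pn d Δ c ≠ 0) (a : Fin n → X) :
    nextProb Pn d Δ c a ≤ 2 / #(typeClass n Pn) := by
  have h1 := h.card_pos hT hM hc
  have h2 : (0 : ℝ) < #(typeClass n Pn) := by exact_mod_cast hT.card_pos
  have h3 := h.card_le hM c (mem_typeClass_of_codebookProb_ne_zero hc)
  simp only [nextProb]
  split_ifs
  · rw [div_le_div_iff₀ h1 h2]; linarith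
  · positivity

/-- Consistency of the laws: drawing one more codeword does not change the distribution of those
before it. -/
theorem HalfCover.sum_codebookProb_mul_init (hM : M + 1 ≤ K) (f : (Fin M → Fin n → X) → ℝ) :
    ∑ c : Fin (M + 1) → Fin n → X, codebookProb Pn d Δ c * f (fun i => c i.castSucc) =
      ∑ c, codebookProb Pn d Δ c * f c := by
  rw [sum_snoc]
  refine sum_congr rfl fun c _ => ?_
  simp only [codebookProb_snoc, Fin.snoc_castSucc]
  by_cases hc : codebookProb Pn d Δ c = 0
  · simp [hc]
  · simp only [mul_right_comm, ← mul_sum, h.sum_nextProb hT (by omega) hc, mul_one]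

-- Whatever the past, the last codeword hits `x` with conditional probability at most `2/|T|`; `f`
-- is an arbitrary weight on the past.
open Classical in
theorem HalfCover.sum_codebookProb_mul_ite_last (hM : M + 1 ≤ K)
    (f : (Fin M → Fin n → X) → ℝ) (hf : ∀ c, 0 ≤ f c) (x : Fin n → X) :
    ∑ c : Fin (M + 1) → Fin n → X, codebookProb Pn d Δ c *
        (f (fun i => c i.castSucc) * if c (Fin.last M) = x then 1 else 0) ≤
      2 / #(typeClass n Pn) * ∑ c, codebookProb Pn d Δ c * f c := by
  rw [sum_snoc, mul_sum]
  refine sum_le_sum fun c _ => ?_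
  simp only [codebookProb_snoc, Fin.snoc_castSucc, Fin.snoc_last, mul_ite, mul_one, mul_zero,
    sum_ite_eq', mem_univ, if_true]
  by_cases hc : codebookProb Pn d Δ c = 0
  · simp [hc]
  · rw [mul_right_comm, mul_comm]
    gcongr
    · exact mul_nonneg (codebookProb_nonneg _) (hf c)
    · exact h.nextProb_le hT (by omega) hc x

theorem HalfCover.sum_codebookProb (hM : M ≤ K) :
    ∑ c : Fin M → Fin n → X, codebookProb Pn d Δ c = 1 := by
  induction M with
  | zero => simp [codebookProb]
  | succ M ih =>
    have := h.sum_codebookProb_mul_init hT hM fun _ => 1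
    simp only [mul_one] at this
    rw [this, ih (by omega)]

open Classical in
theorem HalfCover.prob_codeword_eq_le (hM : M ≤ K) (i : Fin M) (x : Fin n → X) :
    ∑ c : Fin M → Fin n → X, codebookProb Pn d Δ c * (if c i = x then 1 else 0) ≤
      2 / #(typeClass n Pn) := by
  induction M with
  | zero => exact i.elim0
  | succ M ih =>
    refine Fin.lastCases ?_ (fun i => ?_) i
    · have := h.sum_codebookProb_mul_ite_last hT hM (fun _ => 1) (fun _ => zero_le_one) x
      simpa only [one_mul, mul_one, h.sum_codebookProb hT (show M ≤ K by omega)] using this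
    · exact (h.sum_codebookProb_mul_init hT hM fun c => if c i = x then 1 else 0).trans_le
        (ih (by omega) i)

open Classical in
theorem HalfCover.prob_codewords_eq_le (hM : M ≤ K) {i j : Fin M} (hij : i ≠ j)
    (x z : Fin n → X) :
    ∑ c : Fin M → Fin n → X, codebookProb Pn d Δ c *
        ((if c i = x then 1 else 0) * (if c j = z then 1 else 0)) ≤
      2 / #(typeClass n Pn) * (2 / #(typeClass n Pn)) := by
  induction M with
  | zero => exact i.elim0
  | succ M ih =>
    -- The case where one of the two codewords is the last: condition on the past, then bound the
    -- earlier one. In every other case the last codeword is summed out.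
    have key : ∀ (i : Fin M) (x z : Fin n → X),
        ∑ c : Fin (M + 1) → Fin n → X, codebookProb Pn d Δ c *
          ((if c i.castSucc = x then 1 else 0) * (if c (Fin.last M) = z then 1 else 0)) ≤
        2 / #(typeClass n Pn) * (2 / #(typeClass n Pn)) := fun i x z =>
      (h.sum_codebookProb_mul_ite_last hT hM (fun c => if c i = x then 1 else 0)
        (fun c => by positivity) z).trans
        (mul_le_mul_of_nonneg_left (h.prob_codeword_eq_le hT (by omega) i x) (by positivity))
    induction i using Fin.lastCases with
    | last =>
      induction j using Fin.lastCases with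
      | last => exact absurd rfl hij
      | cast j => simpa only [mul_comm (if _ = x then (1 : ℝ) else 0)] using key j z x
    | cast i =>
      induction j using Fin.lastCases with
      | last => exact key i x z
      | cast j =>
        exact (h.sum_codebookProb_mul_init hT hM fun c =>
          (if c i = x then 1 else 0) * (if c j = z then 1 else 0)).trans_le
          (ih (by omega) fun h => hij (by rw [h]))

end

end Codebook

end RGV

namespace RGV

open Finset

/-! ### Joint types of three sequences -/

section TripleType

variable {X Y : Type*} [Fintype X] [Fintype Y] {n : ℕ}

/-- The joint type of three sequences. -/
noncomputable def tripleType {X Y : Type*} {n : ℕ} (x x' : Fin n → X) (y : Fin n → Y) :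
    X × X × Y → ℝ :=
  empirical fun k => (x k, x' k, y k)

theorem margXX_tripleType (x x' : Fin n → X) (y : Fin n → Y) :
    margXX (tripleType x x' y) = jointType x x' := by
  classical
  funext ⟨a, b⟩
  have h := empirical_comp (fun k => (x k, x' k, y k)) (fun c => (c.1, c.2.1)) (a, b)
  refine Eq.trans ?_ h.symm
  refine sum_bij (fun t _ => (a, b, t)) (by simp) (by simp) ?_ (by simp [tripleType])
  rintro ⟨a', b', t⟩ h'
  simp only [mem_filter, mem_univ, true_and, Prod.mk.injEq] at h'
  exact ⟨t, mem_univ _, by rw [h'.1, h'.2]⟩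

theorem margXY_tripleType (x x' : Fin n → X) (y : Fin n → Y) :
    margXY (tripleType x x' y) = jointType x y := by
  classical
  funext ⟨a, b⟩
  have h := empirical_comp (fun k => (x k, x' k, y k)) (fun c => (c.1, c.2.2)) (a, b)
  refine Eq.trans ?_ h.symm
  refine sum_bij (fun t _ => (a, t, b)) (by simp) (by simp) ?_ (by simp [tripleType])
  rintro ⟨a', t, b'⟩ h'
  simp only [mem_filter, mem_univ, true_and, Prod.mk.injEq] at h'
  exact ⟨t, mem_univ _, by rw [h'.1, h'.2]⟩

theorem margX'Y_tripleType (x x' : Fin n → X) (y : Fin n → Y) :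
    margX'Y (tripleType x x' y) = jointType x' y := by
  classical
  funext ⟨a, b⟩
  have h := empirical_comp (fun k => (x k, x' k, y k)) (fun c => (c.2.1, c.2.2)) (a, b)
  refine Eq.trans ?_ h.symm
  refine sum_bij (fun t _ => (t, a, b)) (by simp) (by simp) ?_ (by simp [tripleType])
  rintro ⟨t, a', b'⟩ h'
  simp only [mem_filter, mem_univ, true_and, Prod.mk.injEq] at h'
  exact ⟨t, mem_univ _, by rw [h'.1, h'.2]⟩

theorem pairX'XY_tripleType {X Y : Type*} {n : ℕ} (x x' : Fin n → X) (y : Fin n → Y) :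
    pairX'XY (tripleType x x' y) = jointType x' fun k => (x k, y k) := by
  classical
  funext ⟨b, a, t⟩
  simp only [pairX'XY, tripleType, jointType, empirical, Prod.mk.injEq]
  congr 3
  ext k
  simp only [mem_filter, mem_univ, true_and]
  tauto

-- The pair `(x, y)` is treated as one sequence over the product alphabet, which is why `I(X'; Y,
-- X)` appears.
open Classical in
theorem card_tripleType_eq_le (hn : 0 < n) (x : Fin n → X) (y : Fin n → Y)
    {V : X × X × Y → ℝ} {p : X → ℝ} (hV : marginalSnd (margXX V) = p) :
    (#{x' : Fin n → X | tripleType x x' y = V} : ℝ) ≤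
      (Real.exp 1 * (n + 1)) ^ Fintype.card X * #(typeClass n p) *
        Real.exp (-(n * infoX'YX V)) := by
  have hp : marginalFst (pairX'XY V) = p := by
    rw [← hV]
    funext b
    simp only [marginalFst, pairX'XY, marginalSnd, margXX, Fintype.sum_prod_type]
  have h := card_jointType_eq_le hn (fun k => (x k, y k)) (pairX'XY V)
  rw [hp] at h
  refine le_trans ?_ h
  exact_mod_cast card_le_card fun x' hx' => by
    rw [mem_filter] at hx' ⊢
    exact ⟨mem_univ _, by rw [← pairX'XY_tripleType, hx'.2]⟩

end TripleType

/-! ### The volume condition for the distance `-I` -/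

section VolumeBound

variable {X : Type*} [Fintype X] {n : ℕ}

theorem negInfo_jointType_comm (x z : Fin n → X) :
    negInfo (jointType x z) = negInfo (jointType z x) := by
  unfold negInfo
  rw [← jointType_swap x z, mutualInfo_swap]

-- The ball splits into polynomially many conditional type classes, each with mutual information at
-- least `r`.
open Classical in
theorem card_negInfo_le (hn : 0 < n) (p : X → ℝ) (x : Fin n → X) (r : ℝ) :
    (#{z ∈ typeClass n p | negInfo (jointType z x) ≤ -r} : ℝ) ≤
      (n + 1) ^ Fintype.card (X × X) * ((Real.exp 1 * (n + 1)) ^ Fintype.card X *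
        #(typeClass n p) * Real.exp (-(n * r))) := by
  set s : Finset (Fin n → X) := {z ∈ typeClass n p | negInfo (jointType z x) ≤ -r}
  set 𝒬 := s.image fun z => jointType z x with h𝒬
  have h𝒬card : (#𝒬 : ℝ) ≤ (n + 1) ^ Fintype.card (X × X) := by
    have h1 : #𝒬 ≤ #((univ : Finset (Fin n → X × X)).image empirical) := by
      refine card_le_card fun Q hQ => ?_
      obtain ⟨z, -, rfl⟩ := mem_image.1 hQ
      exact mem_image.2 ⟨fun k => (z k, x k), mem_univ _, rfl⟩
    exact_mod_cast h1.trans (card_image_empirical_le _)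
  have h2 : (#s : ℝ) = ∑ Q ∈ 𝒬, (#{z ∈ s | jointType z x = Q} : ℝ) := by
    exact_mod_cast card_eq_sum_card_image (fun z => jointType z x) s
  rw [h2]
  calc ∑ Q ∈ 𝒬, (#{z ∈ s | jointType z x = Q} : ℝ)
      ≤ ∑ _Q ∈ 𝒬, (Real.exp 1 * (n + 1)) ^ Fintype.card X *
        #(typeClass n p) * Real.exp (-(n * r)) := by
        refine sum_le_sum fun Q hQ => ?_
        obtain ⟨z, hz, rfl⟩ := mem_image.1 hQ
        obtain ⟨hzT, hzI⟩ := mem_filter.1 hz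
        have hm : marginalFst (jointType z x) = p := by
          rw [marginalFst_jointType]; simpa [typeClass] using hzT
        have h3 := card_jointType_eq_le hn x (jointType z x)
        rw [hm] at h3
        have h4 : (#{z' ∈ s | jointType z' x = jointType z x} : ℝ) ≤
            #{z' : Fin n → X | jointType z' x = jointType z x} := by
          exact_mod_cast card_le_card (filter_subset_filter _ (subset_univ s))
        refine h4.trans (h3.trans ?_)
        simp only [negInfo, neg_le_neg_iff] at hzI
        gcongr
    _ = #𝒬 * ((Real.exp 1 * (n + 1)) ^ Fintype.card X *
        #(typeClass n p) * Real.exp (-(n * r))) := by rw [sum_const, nsmul_eq_mul]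
    _ ≤ _ := by gcongr

/-- The exponents add up to `R + δ - (R + 2δ) = -δ`, and this remaining `δ` pays for the polynomial
factor. -/
theorem volumeCondition_negInfo {M : ℕ} {R δ : ℝ} (hn : 0 < n) (hM : 1 ≤ M)
    (hMR : (M : ℝ) ≤ Real.exp (n * R)) (p : X → ℝ)
    (hpoly : (n + 1 : ℝ) ^ Fintype.card (X × X) * (Real.exp 1 * (n + 1)) ^ Fintype.card X ≤
      Real.exp (n * δ)) :
    VolumeCondition n M p negInfo (-(R + 2 * δ)) δ := by
  classical
  intro x _
  have hn' : (n : ℝ) ≠ 0 := by exact_mod_cast hn.ne'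
  have hM' : (0 : ℝ) < M := by exact_mod_cast hM
  have hexp : Real.exp (n * (Real.log M / n + δ)) = M * Real.exp (n * δ) := by
    rw [mul_add, mul_div_cancel₀ _ hn', Real.exp_add, Real.exp_log hM']
  rw [hexp]
  calc (M : ℝ) * Real.exp (n * δ) *
        #{z ∈ typeClass n p | negInfo (jointType z x) ≤ -(R + 2 * δ)}
      ≤ Real.exp (n * R) * Real.exp (n * δ) * ((n + 1) ^ Fintype.card (X × X) *
        ((Real.exp 1 * (n + 1)) ^ Fintype.card X *
        #(typeClass n p) * Real.exp (-(n * (R + 2 * δ))))) := by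
        gcongr
        exact card_negInfo_le hn p x _
    _ = ((n + 1) ^ Fintype.card (X × X) * (Real.exp 1 * (n + 1)) ^ Fintype.card X) *
        #(typeClass n p) *
        (Real.exp (n * R) * Real.exp (n * δ) * Real.exp (-(n * (R + 2 * δ)))) := by ring
    _ ≤ Real.exp (n * δ) * #(typeClass n p) *
        (Real.exp (n * R) * Real.exp (n * δ) * Real.exp (-(n * (R + 2 * δ)))) := by gcongr
    _ = #(typeClass n p) * (Real.exp (n * δ) *
        (Real.exp (n * R) * Real.exp (n * δ) * Real.exp (-(n * (R + 2 * δ))))) := by ring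
    _ = #(typeClass n p) := by
        rw [← Real.exp_add, ← Real.exp_add, ← Real.exp_add]
        ring_nf
        simp

theorem halfCover_of_volumeCondition {M : ℕ} {p : X → ℝ} {d : (X × X → ℝ) → ℝ} {Δ δ : ℝ}
    (hn : 0 < n) (hM : 1 ≤ M) (h : VolumeCondition n M p d Δ δ)
    (h2 : 2 ≤ Real.exp (n * δ)) : HalfCover p d Δ n M := by
  classical
  intro x hx
  have hn' : (n : ℝ) ≠ 0 := by exact_mod_cast hn.ne'
  have hM' : (0 : ℝ) < M := by exact_mod_cast hM
  have hexp : Real.exp (n * (Real.log M / n + δ)) = M * Real.exp (n * δ) := by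
    rw [mul_add, mul_div_cancel₀ _ hn', Real.exp_add, Real.exp_log hM']
  have h3 := h x hx
  rw [hexp] at h3
  refine le_trans ?_ h3
  rw [← mul_assoc, mul_comm 2 (M : ℝ)]
  gcongr

end VolumeBound

/-! ### The ensemble error probability -/

section Error

variable {X Y : Type*} [Fintype X] [Fintype Y] {n : ℕ}

theorem channelPow_nonneg {X Y : Type*} {n : ℕ} {W : X → Y → ℝ} (hW : ∀ x y, 0 ≤ W x y)
    (x : Fin n → X) (y : Fin n → Y) : 0 ≤ channelPow W x y :=
  prod_nonneg fun _ _ => hW _ _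

open Classical in
/-- The sequences that may be confused with `x` when `y` is received. -/
noncomputable def confusable (p : X → ℝ) (d : (X × X → ℝ) → ℝ) (Δ : ℝ) (q : (X × Y → ℝ) → ℝ)
    (x : Fin n → X) (y : Fin n → Y) : Finset (Fin n → X) :=
  {x' ∈ typeClass n p | Δ < d (jointType x x') ∧ q (jointType x y) ≤ q (jointType x' y)}

/-- The later of the two codewords was drawn outside the ball of the earlier one; symmetry of `d`
makes the order irrelevant. -/
theorem lt_distance_of_codebookProb_ne_zero {M : ℕ} {p : X → ℝ} {d : (X × X → ℝ) → ℝ} {Δ : ℝ}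
    (hd : ∀ x z : Fin n → X, d (jointType x z) = d (jointType z x)) {c : Fin M → Fin n → X}
    (hc : codebookProb p d Δ c ≠ 0) {i m : Fin M} (him : i ≠ m) :
    Δ < d (jointType (c m) (c i)) := by
  rcases lt_or_gt_of_ne him with h | h
  · exact (mem_filter.1 (mem_admissible_of_codebookProb_ne_zero hc m)).2 i h
  · rw [hd]
    exact (mem_filter.1 (mem_admissible_of_codebookProb_ne_zero hc i)).2 m h

-- The bound 1 in the minimum comes from dropping the error event, the other from a union bound over
-- competing indices and their possible values.
open Classical in
theorem HalfCover.prob_confusion_le {X Y : Type*} [Fintype X] {n : ℕ} {M : ℕ} {p : X → ℝ} {d : (X × X → ℝ) → ℝ} {Δ : ℝ}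
    (h : HalfCover p d Δ n M) (hT : (typeClass n p).Nonempty)
    (hd : ∀ x z : Fin n → X, d (jointType x z) = d (jointType z x))
    (q : (X × Y → ℝ) → ℝ) (m : Fin M) (x : Fin n → X) (y : Fin n → Y) :
    ∑ c : Fin M → Fin n → X, codebookProb p d Δ c * ((if c m = x then 1 else 0) *
        if ∃ i, i ≠ m ∧ q (jointType (c m) y) ≤ q (jointType (c i) y) then 1 else 0) ≤
      2 / #(typeClass n p) *
        min (1 : ℝ) (M * (2 / #(typeClass n p)) * #(confusable p d Δ q x y)) := by
  set τ : ℝ := 2 / #(typeClass n p) with hτ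
  have hτ0 : 0 ≤ τ := by positivity
  rw [mul_min_of_nonneg _ _ hτ0, mul_one]
  refine le_min ?_ ?_
  · refine le_trans (sum_le_sum fun c _ => ?_) (h.prob_codeword_eq_le hT le_rfl m x)
    refine mul_le_mul_of_nonneg_left ?_ (codebookProb_nonneg c)
    refine mul_le_of_le_one_right (by positivity) ?_
    split_ifs <;> norm_num
  · calc ∑ c : Fin M → Fin n → X, codebookProb p d Δ c * ((if c m = x then 1 else 0) *
          if ∃ i, i ≠ m ∧ q (jointType (c m) y) ≤ q (jointType (c i) y) then 1 else 0)
        ≤ ∑ c : Fin M → Fin n → X, ∑ i ∈ univ.erase m, ∑ x' ∈ confusable p d Δ q x y,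
          codebookProb p d Δ c *
            ((if c m = x then 1 else 0) * (if c i = x' then 1 else 0)) := by
          refine sum_le_sum fun c _ => ?_
          have hnn : 0 ≤ ∑ i ∈ univ.erase m, ∑ x' ∈ confusable p d Δ q x y,
              codebookProb p d Δ c *
                ((if c m = x then (1 : ℝ) else 0) * (if c i = x' then 1 else 0)) :=
            sum_nonneg fun i _ => sum_nonneg fun x' _ =>
              mul_nonneg (codebookProb_nonneg c) (by positivity)
          by_cases hc : codebookProb p d Δ c = 0
          · simp [hc]
          by_cases hx : c m = x
          swap
          · simpa only [if_neg hx, zero_mul, mul_zero] using hnn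
          by_cases hi : ∃ i, i ≠ m ∧ q (jointType (c m) y) ≤ q (jointType (c i) y)
          swap
          · simpa only [if_neg hi, mul_zero] using hnn
          rw [if_pos hi]
          obtain ⟨i, him, hq⟩ := hi
          have hmem : c i ∈ confusable p d Δ q x y := by
            refine mem_filter.2 ⟨mem_typeClass_of_codebookProb_ne_zero hc i, ?_, ?_⟩
            · rw [← hx]; exact lt_distance_of_codebookProb_ne_zero hd hc him
            · rw [← hx]; exact hq
          refine le_trans ?_ (single_le_sum (fun i _ => sum_nonneg fun x' _ =>
            mul_nonneg (codebookProb_nonneg c) (by positivity))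
            (mem_erase.2 ⟨him, mem_univ i⟩))
          refine le_trans ?_ (single_le_sum (fun x' _ =>
            mul_nonneg (codebookProb_nonneg c) (by positivity)) hmem)
          simp [hx]
      _ = ∑ i ∈ univ.erase m, ∑ x' ∈ confusable p d Δ q x y, ∑ c : Fin M → Fin n → X,
          codebookProb p d Δ c *
            ((if c m = x then 1 else 0) * (if c i = x' then 1 else 0)) := by
          rw [sum_comm]
          exact sum_congr rfl fun i _ => sum_comm
      _ ≤ ∑ i ∈ univ.erase m, ∑ x' ∈ confusable p d Δ q x y, τ * τ :=
          sum_le_sum fun i hi => sum_le_sum fun x' _ =>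
            h.prob_codewords_eq_le hT le_rfl (ne_of_mem_erase hi).symm x x'
      _ = #(univ.erase m) * (#(confusable p d Δ q x y) * (τ * τ)) := by
          rw [sum_const, sum_const, nsmul_eq_mul, nsmul_eq_mul]
      _ ≤ M * (#(confusable p d Δ q x y) * (τ * τ)) := by
          gcongr
          exact (card_le_univ _).trans (by simp)
      _ = τ * (M * τ * #(confusable p d Δ q x y)) := by ring

theorem HalfCover.ensembleErrorProb_le {M : ℕ} (hM : 1 ≤ M) {p : X → ℝ}
    {d : (X × X → ℝ) → ℝ} {Δ : ℝ}
    (h : HalfCover p d Δ n M) (hT : (typeClass n p).Nonempty)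
    (hd : ∀ x z : Fin n → X, d (jointType x z) = d (jointType z x))
    {W : X → Y → ℝ} (hW : ∀ x y, 0 ≤ W x y) (q : (X × Y → ℝ) → ℝ) :
    ensembleErrorProb n M p d Δ W q ≤
      2 / #(typeClass n p) * ∑ x ∈ typeClass n p, ∑ y : Fin n → Y, channelPow W x y *
        min (1 : ℝ) (M * (2 / #(typeClass n p)) * #(confusable p d Δ q x y)) := by
  classical
  have hM' : (0 : ℝ) < M := by exact_mod_cast hM
  set S : ℝ := 2 / #(typeClass n p) * ∑ x ∈ typeClass n p, ∑ y : Fin n → Y, channelPow W x y *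
        min (1 : ℝ) (M * (2 / #(typeClass n p)) * #(confusable p d Δ q x y)) with hS
  have hm : ∀ m : Fin M, ∑ c : Fin M → Fin n → X, codebookProb p d Δ c *
      (∑ y : Fin n → Y, if ∃ i, i ≠ m ∧ q (jointType (c m) y) ≤ q (jointType (c i) y)
        then channelPow W (c m) y else 0) ≤ S := by
    intro m
    calc ∑ c : Fin M → Fin n → X, codebookProb p d Δ c *
        (∑ y : Fin n → Y, if ∃ i, i ≠ m ∧ q (jointType (c m) y) ≤ q (jointType (c i) y)
          then channelPow W (c m) y else 0)
        = ∑ c : Fin M → Fin n → X, ∑ x ∈ typeClass n p, ∑ y : Fin n → Y, channelPow W x y *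
          (codebookProb p d Δ c * ((if c m = x then 1 else 0) *
            if ∃ i, i ≠ m ∧ q (jointType (c m) y) ≤ q (jointType (c i) y) then 1 else 0)) := by
          refine sum_congr rfl fun c _ => ?_
          by_cases hc : codebookProb p d Δ c = 0
          · simp [hc]
          rw [sum_eq_single_of_mem (c m) (mem_typeClass_of_codebookProb_ne_zero hc m), mul_sum]
          · refine sum_congr rfl fun y _ => ?_
            rw [if_pos rfl]
            split_ifs <;> ring
          · intro x _ hx
            simp [hx.symm]
      _ = ∑ x ∈ typeClass n p, ∑ y : Fin n → Y, channelPow W x y *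
          ∑ c : Fin M → Fin n → X, (codebookProb p d Δ c * ((if c m = x then 1 else 0) *
            if ∃ i, i ≠ m ∧ q (jointType (c m) y) ≤ q (jointType (c i) y) then 1 else 0)) := by
          rw [sum_comm]
          refine sum_congr rfl fun x _ => ?_
          rw [sum_comm]
          exact sum_congr rfl fun y _ => (mul_sum _ _ _).symm
      _ ≤ ∑ x ∈ typeClass n p, ∑ y : Fin n → Y, channelPow W x y *
          (2 / #(typeClass n p) *
            min (1 : ℝ) (M * (2 / #(typeClass n p)) * #(confusable p d Δ q x y))) :=
          sum_le_sum fun x _ => sum_le_sum fun y _ =>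
            mul_le_mul_of_nonneg_left (h.prob_confusion_le hT hd q m x y)
              (channelPow_nonneg hW x y)
      _ = S := by
          rw [hS, mul_sum]
          refine sum_congr rfl fun x _ => ?_
          rw [mul_sum]
          exact sum_congr rfl fun y _ => by ring
  calc ensembleErrorProb n M p d Δ W q
      = 1 / M * ∑ m : Fin M, ∑ c : Fin M → Fin n → X, codebookProb p d Δ c *
        (∑ y : Fin n → Y, if ∃ i, i ≠ m ∧ q (jointType (c m) y) ≤ q (jointType (c i) y)
          then channelPow W (c m) y else 0) := by
        rw [sum_comm, mul_sum, ensembleErrorProb]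
        refine sum_congr rfl fun c _ => ?_
        rw [← mul_sum, errorProb]
        ring
    _ ≤ 1 / M * ∑ _m : Fin M, S := by
        gcongr
        exact hm _
    _ = S := by
        rw [sum_const, card_univ, Fintype.card_fin, nsmul_eq_mul]
        field_simp

open Classical in
/-- The joint types of a codeword, a confusable sequence and a channel output. -/
noncomputable def confusionTypes (n : ℕ) (p : X → ℝ) (d : (X × X → ℝ) → ℝ) (Δ : ℝ)
    (q : (X × Y → ℝ) → ℝ) : Finset (X × X × Y → ℝ) :=
  (univ.filter fun t : (Fin n → X) × (Fin n → X) × (Fin n → Y) =>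
    t.1 ∈ typeClass n p ∧ t.2.1 ∈ confusable p d Δ q t.1 t.2.2).image
      fun t => tripleType t.1 t.2.1 t.2.2

theorem mem_confusionTypes {p : X → ℝ} {d : (X × X → ℝ) → ℝ} {Δ : ℝ} {q : (X × Y → ℝ) → ℝ}
    {V : X × X × Y → ℝ} : V ∈ confusionTypes n p d Δ q ↔
      ∃ (x x' : Fin n → X) (y : Fin n → Y), x ∈ typeClass n p ∧
        x' ∈ confusable p d Δ q x y ∧ tripleType x x' y = V := by
  classical
  simp only [confusionTypes, mem_image, mem_filter, mem_univ, true_and, Prod.exists, and_assoc]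

theorem confusionTypes_spec (hn : 0 < n) {p : X → ℝ} {d : (X × X → ℝ) → ℝ} {Δ : ℝ}
    {q : (X × Y → ℝ) → ℝ} {V : X × X × Y → ℝ} (hV : V ∈ confusionTypes n p d Δ q) :
    V ∈ stdSimplex ℝ (X × X × Y) ∧ marginalFst (margXX V) = p ∧ marginalSnd (margXX V) = p ∧
      Δ < d (margXX V) ∧ q (margXY V) ≤ q (margX'Y V) := by
  classical
  obtain ⟨x, x', y, hx, hx', rfl⟩ := mem_confusionTypes.1 hV
  obtain ⟨hx'T, hd, hq⟩ := mem_filter.1 hx'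
  rw [margXX_tripleType, margXY_tripleType, margX'Y_tripleType, marginalFst_jointType,
    marginalSnd_jointType]
  refine ⟨empirical_mem_stdSimplex hn _, ?_, ?_, hd, hq⟩
  · simpa [typeClass] using hx
  · simpa [typeClass] using hx'T

theorem card_confusionTypes_le (p : X → ℝ) (d : (X × X → ℝ) → ℝ) (Δ : ℝ)
    (q : (X × Y → ℝ) → ℝ) :
    (#(confusionTypes n p d Δ q) : ℝ) ≤ (n + 1) ^ Fintype.card (X × X × Y) := by
  classical
  have h : #(confusionTypes n p d Δ q) ≤
      #((univ : Finset (Fin n → X × X × Y)).image empirical) := by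
    refine card_le_card fun V hV => ?_
    obtain ⟨x, x', y, -, -, rfl⟩ := mem_confusionTypes.1 hV
    exact mem_image.2 ⟨fun k => (x k, x' k, y k), mem_univ _, rfl⟩
  exact_mod_cast h.trans (card_image_empirical_le _)

open Classical in
theorem card_confusable_le {p : X → ℝ} {d : (X × X → ℝ) → ℝ} {Δ : ℝ} {q : (X × Y → ℝ) → ℝ}
    {x : Fin n → X} (hx : x ∈ typeClass n p) (y : Fin n → Y) :
    #(confusable p d Δ q x y) ≤
      ∑ V ∈ confusionTypes n p d Δ q, #{x' : Fin n → X | tripleType x x' y = V} := by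
  rw [card_eq_sum_card_fiberwise (f := fun x' => tripleType x x' y)
    (t := confusionTypes n p d Δ q)]
  · exact sum_le_sum fun V _ => card_le_card (filter_subset_filter _ (subset_univ _))
  · intro x' hx'
    exact mem_confusionTypes.2 ⟨x, x', y, hx, hx', rfl⟩

/-- Subadditivity of the truncation: it can be applied to each joint type separately, which yields
`|I - R|₊` type by type. -/
theorem min_one_sum_le {ι : Type*} (s : Finset ι) (f : ι → ℝ) (hf : ∀ i, 0 ≤ f i) :
    min 1 (∑ i ∈ s, f i) ≤ ∑ i ∈ s, min 1 (f i) := by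
  by_cases h : ∃ i ∈ s, 1 ≤ f i
  · obtain ⟨i, hi, h1⟩ := h
    refine (min_le_left _ _).trans ((le_of_eq (min_eq_left h1).symm).trans ?_)
    exact single_le_sum (f := fun i => min 1 (f i)) (fun j _ => le_min zero_le_one (hf j)) hi
  · push Not at h
    exact (min_le_right _ _).trans (sum_le_sum fun i hi => (min_eq_right (h i hi).le).ge)

theorem channelPow_eq_zero_of_not_ac (hn : 0 < n) {W : X → Y → ℝ} {x : Fin n → X}
    {y : Fin n → Y} (h : jointType x y ∉ acSet W) : channelPow W x y = 0 := by
  classical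
  by_contra hne
  refine h ⟨empirical_mem_stdSimplex hn _, fun a b hab => ?_⟩
  have hempty : ({k | (x k, y k) = (a, b)} : Finset (Fin n)) = ∅ := by
    refine filter_eq_empty_iff.2 fun k _ hk => ?_
    rw [Prod.mk.injEq] at hk
    exact prod_ne_zero_iff.1 hne k (mem_univ k) (by rw [hk.1, hk.2, hab])
  simp only [jointType, empirical]
  simp only [Prod.mk.injEq] at hempty ⊢
  simp [hempty]

-- The outputs that contribute all have joint type `margXY V` with `x`. Their total probability
-- gives the divergence term and the truncated union bound gives `|I - R|₊`.
open Classical in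
theorem sum_channelPow_mul_min_le (hn : 0 < n) {M : ℕ} {R : ℝ} (hMR : (M : ℝ) ≤ Real.exp (n * R))
    {p : X → ℝ} (hT : (typeClass n p).Nonempty) {W : X → Y → ℝ} (hW : ∀ x y, 0 ≤ W x y)
    (x : Fin n → X) {V : X × X × Y → ℝ} (hV : marginalSnd (margXX V) = p) :
    ∑ y : Fin n → Y, channelPow W x y *
        min (1 : ℝ) (M * (2 / #(typeClass n p)) * #{x' : Fin n → X | tripleType x x' y = V}) ≤
      if margXY V ∈ acSet W then
        2 * (Real.exp 1 * (n + 1)) ^ Fintype.card X * Real.exp (-(n * ckObjective R W V))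
      else 0 := by
  have hT' : (0 : ℝ) < #(typeClass n p) := by exact_mod_cast hT.card_pos
  have hzero : ∀ y : Fin n → Y, jointType x y ≠ margXY V →
      (#{x' : Fin n → X | tripleType x x' y = V} : ℝ) = 0 := by
    intro y hy
    rw [Nat.cast_eq_zero, card_eq_zero, filter_eq_empty_iff]
    intro x' _ hx'
    exact hy (by rw [← hx', margXY_tripleType])
  set c : ℝ := (Real.exp 1 * (n + 1)) ^ Fintype.card X
  have hc : 1 ≤ c := by
    refine one_le_pow₀ ?_
    have h1 := Real.one_le_exp (zero_le_one (α := ℝ))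
    have h2 : (1 : ℝ) ≤ n + 1 := by linarith [Nat.cast_nonneg (α := ℝ) n]
    nlinarith
  split_ifs with hac
  · have hmin : ∀ y : Fin n → Y,
        min (1 : ℝ) (M * (2 / #(typeClass n p)) * #{x' : Fin n → X | tripleType x x' y = V}) ≤
          2 * c * Real.exp (-(n * max (infoX'YX V - R) 0)) := by
      intro y
      -- Count competitors when `I - R` is the maximum; otherwise use the trivial bound `1 ≤ 2 * c`.
      rcases max_choice (infoX'YX V - R) 0 with h | h
      · rw [h]
        refine (min_le_right _ _).trans ?_
        calc (M : ℝ) * (2 / #(typeClass n p)) * #{x' : Fin n → X | tripleType x x' y = V}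
            ≤ Real.exp (n * R) * (2 / #(typeClass n p)) *
              (c * #(typeClass n p) * Real.exp (-(n * infoX'YX V))) := by
              gcongr
              exact card_tripleType_eq_le hn x y hV
          _ = 2 * c * (Real.exp (n * R) * Real.exp (-(n * infoX'YX V))) := by
              field_simp
          _ = _ := by
              rw [← Real.exp_add]; ring_nf
      · rw [h]
        refine (min_le_left _ _).trans ?_
        simp only [mul_zero, neg_zero, Real.exp_zero]
        linarith
    calc ∑ y : Fin n → Y, channelPow W x y *
          min (1 : ℝ) (M * (2 / #(typeClass n p)) * #{x' : Fin n → X | tripleType x x' y = V})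
        = ∑ y : Fin n → Y with jointType x y = margXY V, channelPow W x y *
          min (1 : ℝ) (M * (2 / #(typeClass n p)) * #{x' : Fin n → X | tripleType x x' y = V}) := by
          refine (sum_subset (filter_subset _ _) fun y _ hy => ?_).symm
          rw [hzero y fun h => hy (mem_filter.2 ⟨mem_univ _, h⟩)]
          simp
      _ ≤ ∑ y : Fin n → Y with jointType x y = margXY V, channelPow W x y *
          (2 * c * Real.exp (-(n * max (infoX'YX V - R) 0))) :=
          sum_le_sum fun y _ => mul_le_mul_of_nonneg_left (hmin y) (channelPow_nonneg hW x y)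
      _ = (∑ y : Fin n → Y with jointType x y = margXY V, ∏ k, W (x k) (y k)) *
          (2 * c * Real.exp (-(n * max (infoX'YX V - R) 0))) := (sum_mul _ _ _).symm
      _ ≤ Real.exp (-(n * condDivReal (margXY V) W)) *
          (2 * c * Real.exp (-(n * max (infoX'YX V - R) 0))) := by
          gcongr
          exact sum_prod_le_exp hn x (margXY V) W hW hac.2
      _ = 2 * c * Real.exp (-(n * ckObjective R W V)) := by
          rw [ckObjective, mul_add, neg_add, Real.exp_add]
          ring
  · refine (sum_eq_zero fun y _ => ?_).le
    by_cases hy : jointType x y = margXY V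
    · rw [channelPow_eq_zero_of_not_ac hn (by rwa [hy]), zero_mul]
    · rw [hzero y hy]
      simp

open Classical in
/-- The ensemble error probability is at most a sum over joint types of
`exp (-n (D(V_{Y|X} ‖ W | P) + |I(X'; Y, X) - R|₊))`, up to a polynomial factor. -/
theorem HalfCover.ensembleErrorProb_le_sum (hn : 0 < n) {M : ℕ} (hM : 1 ≤ M) {R : ℝ}
    (hMR : (M : ℝ) ≤ Real.exp (n * R)) {p : X → ℝ} {d : (X × X → ℝ) → ℝ} {Δ : ℝ}
    (h : HalfCover p d Δ n M) (hT : (typeClass n p).Nonempty)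
    (hd : ∀ x z : Fin n → X, d (jointType x z) = d (jointType z x))
    {W : X → Y → ℝ} (hW : ∀ x y, 0 ≤ W x y) (q : (X × Y → ℝ) → ℝ) :
    ensembleErrorProb n M p d Δ W q ≤
      ∑ V ∈ confusionTypes n p d Δ q, if margXY V ∈ acSet W then
        4 * (Real.exp 1 * (n + 1)) ^ Fintype.card X * Real.exp (-(n * ckObjective R W V))
      else 0 := by
  have hT' : (0 : ℝ) < #(typeClass n p) := by exact_mod_cast hT.card_pos
  refine (h.ensembleErrorProb_le hM hT hd hW q).trans ?_
  set τ : ℝ := 2 / #(typeClass n p) with hτ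
  calc τ * ∑ x ∈ typeClass n p, ∑ y : Fin n → Y, channelPow W x y *
        min (1 : ℝ) (M * τ * #(confusable p d Δ q x y))
      ≤ τ * ∑ x ∈ typeClass n p, ∑ y : Fin n → Y, ∑ V ∈ confusionTypes n p d Δ q,
        channelPow W x y *
          min (1 : ℝ) (M * τ * #{x' : Fin n → X | tripleType x x' y = V}) := by
        refine mul_le_mul_of_nonneg_left (sum_le_sum fun x hx => sum_le_sum fun y _ => ?_)
          (by positivity)
        rw [← mul_sum]
        refine mul_le_mul_of_nonneg_left ?_ (channelPow_nonneg hW x y)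
        refine le_trans ?_ (min_one_sum_le _ _ fun V => by positivity)
        refine min_le_min_left 1 ?_
        rw [← mul_sum]
        gcongr
        exact_mod_cast card_confusable_le hx y
    _ = ∑ V ∈ confusionTypes n p d Δ q, τ * ∑ x ∈ typeClass n p, ∑ y : Fin n → Y,
        channelPow W x y *
          min (1 : ℝ) (M * τ * #{x' : Fin n → X | tripleType x x' y = V}) := by
        rw [← mul_sum]
        congr 1
        exact (sum_congr rfl fun x _ => sum_comm).trans sum_comm
    _ ≤ ∑ V ∈ confusionTypes n p d Δ q, τ * ∑ x ∈ typeClass n p,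
        if margXY V ∈ acSet W then
          2 * (Real.exp 1 * (n + 1)) ^ Fintype.card X * Real.exp (-(n * ckObjective R W V))
        else 0 :=
        sum_le_sum fun V hV => mul_le_mul_of_nonneg_left (sum_le_sum fun x _ =>
          sum_channelPow_mul_min_le hn hMR hT hW x (confusionTypes_spec hn hV).2.2.1)
          (by positivity)
    _ = _ := by
        refine sum_congr rfl fun V _ => ?_
        rw [sum_const, nsmul_eq_mul]
        split_ifs
        · rw [hτ]; field_simp; ring
        · simp

theorem le_exponent_of_le {p C e η : ℝ} (hn : 0 < n) (hp : 0 ≤ p)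
    (h : p ≤ C * Real.exp (-(n * e))) (hC : C ≤ Real.exp (n * η)) :
    ((e - η : ℝ) : EReal) ≤ exponent n p := by
  unfold exponent
  split_ifs with h0
  · exact le_top
  have hn' : (0 : ℝ) < n := by exact_mod_cast hn
  have hp' : 0 < p := lt_of_le_of_ne hp (Ne.symm h0)
  have h1 : p ≤ Real.exp (n * (η - e)) := by
    refine h.trans ((mul_le_mul_of_nonneg_right hC (Real.exp_pos _).le).trans_eq ?_)
    rw [← Real.exp_add]; ring_nf
  have h2 := (Real.log_le_iff_le_exp hp').2 h1
  refine EReal.coe_le_coe_iff.2 ?_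
  rw [neg_mul, one_div, inv_mul_eq_div, le_neg, div_le_iff₀ hn']
  linarith

theorem ensembleErrorProb_nonneg {M : ℕ} (p : X → ℝ) (d : (X × X → ℝ) → ℝ) (Δ : ℝ)
    {W : X → Y → ℝ} (hW : ∀ x y, 0 ≤ W x y) (q : (X × Y → ℝ) → ℝ) :
    0 ≤ ensembleErrorProb n M p d Δ W q := by
  classical
  refine sum_nonneg fun c _ => mul_nonneg (codebookProb_nonneg c) ?_
  refine mul_nonneg (by positivity) (sum_nonneg fun m _ => sum_nonneg fun y _ => ?_)
  split_ifs
  · exact channelPow_nonneg hW _ _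
  · exact le_rfl

end Error

end RGV

/-! ### Choice of the constants and conclusion -/

theorem mainTheorem3 {X Y : Type*} [Fintype X] [Fintype Y]
    (W : X → Y → ℝ) (hW : ∀ x, W x ∈ stdSimplex ℝ Y)
    (P : X → ℝ) (hP : P ∈ stdSimplex ℝ X)
    (q : (X × Y → ℝ) → ℝ) (hq : ContinuousOn q (stdSimplex ℝ (X × Y)))
    (R ε : ℝ) (hε : 0 < ε) :
    RGV.IsDistanceFunction (RGV.negInfo : (X × X → ℝ) → ℝ) ∧
    (∀ δ : ℝ, 0 < δ → RGV.RateCondition R P RGV.negInfo (-(R + 2 * δ)) δ) ∧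
    ∃ δ₀ : ℝ, 0 < δ₀ ∧ ∀ δ : ℝ, 0 < δ → δ < δ₀ →
      ∃ N : ℕ, ∀ n : ℕ, N ≤ n → ∀ Pn : X → ℝ, RGV.IsApproxType P n Pn →
        ∀ M : ℕ, 1 ≤ M → (M : ℝ) ≤ Real.exp (n * R) →
          RGV.VolumeCondition n M Pn RGV.negInfo (-(R + 2 * δ)) δ ∧
          ∑ c : Fin M → Fin n → X, RGV.codebookProb Pn RGV.negInfo (-(R + 2 * δ)) c = 1 ∧
          RGV.ckExponent q R P W - (ε : EReal) ≤
            RGV.exponent n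
              (RGV.ensembleErrorProb n M Pn RGV.negInfo (-(R + 2 * δ)) W q) := by
  classical
  refine ⟨RGV.isDistanceFunction_negInfo, fun δ _ => RGV.rateCondition_negInfo R P δ, ?_⟩
  have hW0 : ∀ x y, 0 ≤ W x y := fun x => (hW x).1
  obtain ⟨η, hη, hslack⟩ := RGV.exists_slack_ckExponent hq R P W (half_pos hε)
  -- Competing codewords satisfy `I(X; X') < R + 2δ`, which stays below `R + η` for `δ < η / 2`.
  refine ⟨η / 2, by positivity, fun δ hδ hδη => ?_⟩
  -- The thresholds serve, in turn, the volume condition, `2 ≤ e^{nδ}`, the polynomial factor of the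
  -- error bound, and `1/n < η`.
  obtain ⟨N₁, hN₁⟩ := RGV.eventually_mul_pow_le_exp 1
    (Fintype.card (X × X) + Fintype.card X) hδ
  obtain ⟨N₂, hN₂⟩ := RGV.eventually_mul_pow_le_exp 2 0 hδ
  obtain ⟨N₃, hN₃⟩ := RGV.eventually_mul_pow_le_exp 4
    (Fintype.card (X × X × Y) + Fintype.card X) (half_pos hε)
  obtain ⟨N₄, hN₄⟩ := exists_nat_gt (1 / η)
  refine ⟨N₁ + N₂ + N₃ + N₄ + 1, fun n hn Pn hPn M hM hMR => ?_⟩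
  have hn0 : 0 < n := by omega
  have hn0' : (0 : ℝ) < n := by exact_mod_cast hn0
  have hbase : ∀ k : ℕ, (n + 1 : ℝ) ^ k ≤ (Real.exp 1 * (n + 1)) ^ k := fun k => by
    gcongr
    exact le_mul_of_one_le_left (by positivity) (Real.one_le_exp zero_le_one)
  have hpoly := hN₁ n (by omega)
  rw [one_mul, pow_add] at hpoly
  have hvol : RGV.VolumeCondition n M Pn RGV.negInfo (-(R + 2 * δ)) δ :=
    RGV.volumeCondition_negInfo hn0 hM hMR Pn
      ((mul_le_mul_of_nonneg_right (hbase _) (by positivity)).trans hpoly)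
  have hcover : RGV.HalfCover Pn RGV.negInfo (-(R + 2 * δ)) n M :=
    RGV.halfCover_of_volumeCondition hn0 hM hvol (by simpa using hN₂ n (by omega))
  have hT : (RGV.typeClass n Pn).Nonempty := by
    obtain ⟨x, hx⟩ := hPn.1
    exact ⟨x, by simp [RGV.typeClass, hx]⟩
  refine ⟨hvol, hcover.sum_codebookProb hT le_rfl, ?_⟩
  have hnη : (1 : ℝ) / n < η := by
    rw [div_lt_comm₀ hn0' hη]
    refine hN₄.trans_le ?_
    exact_mod_cast (by omega : N₄ ≤ n)
  have hspec : ∀ V ∈ RGV.confusionTypes n Pn RGV.negInfo (-(R + 2 * δ)) q,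
      RGV.margXY V ∈ RGV.acSet W → V ∈ RGV.confusionSet q W ∧
        (∀ a, |RGV.marginalFst (RGV.margXX V) a - P a| < η) ∧
        (∀ a, |RGV.marginalSnd (RGV.margXX V) a - P a| < η) ∧
        RGV.mutualInfo (RGV.margXX V) < R + η := by
    intro V hV hac
    obtain ⟨h1, h2, h3, h4, h5⟩ := RGV.confusionTypes_spec hn0 hV
    refine ⟨⟨h1, hac, h5⟩, fun a => ?_, fun a => ?_, ?_⟩
    · rw [h2]; exact (hPn.2.2 a).trans_lt hnη
    · rw [h3]; exact (hPn.2.2 a).trans_lt hnη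
    · simp only [RGV.negInfo, neg_lt_neg_iff] at h4
      linarith
  have hsum := hcover.ensembleErrorProb_le_sum hn0 hM hMR hT
    RGV.negInfo_jointType_comm hW0 q
  have hnn := RGV.ensembleErrorProb_nonneg (n := n) (M := M) Pn RGV.negInfo
    (-(R + 2 * δ)) hW0 q
  set 𝒱 := (RGV.confusionTypes n Pn RGV.negInfo (-(R + 2 * δ)) q).filter
    fun V => RGV.margXY V ∈ RGV.acSet W with h𝒱
  rw [← Finset.sum_filter] at hsum
  -- If no type contributes, the error probability is exactly 0. An infinite exponent always leads
  -- here, since a member of `𝒱` would bound it by a real number in `hE`.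
  rcases 𝒱.eq_empty_or_nonempty with hempty | hne
  · rw [← h𝒱, hempty, Finset.sum_empty] at hsum
    rw [RGV.exponent, if_pos (le_antisymm hsum hnn)]
    exact le_top
  obtain ⟨V₀, hV₀, hmin⟩ := 𝒱.exists_min_image (RGV.ckObjective R W) hne
  obtain ⟨hV₀T, hV₀ac⟩ := Finset.mem_filter.1 hV₀
  obtain ⟨h1, h2, h3, h4⟩ := hspec V₀ hV₀T hV₀ac
  have hE := hslack V₀ h1 h2 h3 h4
  set e := RGV.ckObjective R W V₀
  have hle : RGV.ensembleErrorProb n M Pn RGV.negInfo (-(R + 2 * δ)) W q ≤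
      4 * (Real.exp 1 * (n + 1)) ^ (Fintype.card (X × X × Y) + Fintype.card X) *
        Real.exp (-(n * e)) := by
    calc RGV.ensembleErrorProb n M Pn RGV.negInfo (-(R + 2 * δ)) W q
        ≤ ∑ V ∈ 𝒱, 4 * (Real.exp 1 * (n + 1)) ^ Fintype.card X *
          Real.exp (-(n * RGV.ckObjective R W V)) := hsum
      _ ≤ ∑ _V ∈ 𝒱, 4 * (Real.exp 1 * (n + 1)) ^ Fintype.card X * Real.exp (-(n * e)) := by
          refine Finset.sum_le_sum fun V hV => ?_
          gcongr
          exact hmin V hV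
      _ = 𝒱.card * (4 * (Real.exp 1 * (n + 1)) ^ Fintype.card X * Real.exp (-(n * e))) := by
          rw [Finset.sum_const, nsmul_eq_mul]
      _ ≤ (Real.exp 1 * (n + 1)) ^ Fintype.card (X × X × Y) *
          (4 * (Real.exp 1 * (n + 1)) ^ Fintype.card X * Real.exp (-(n * e))) := by
          gcongr
          refine le_trans ?_ ((RGV.card_confusionTypes_le Pn RGV.negInfo
            (-(R + 2 * δ)) q).trans (hbase _))
          exact_mod_cast Finset.card_filter_le _ _
      _ = _ := by rw [pow_add]; ring
  refine le_trans ?_ (RGV.le_exponent_of_le hn0 hnn hle (hN₃ n (by omega)))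
  calc RGV.ckExponent q R P W - (ε : EReal)
      ≤ ((e + ε / 2 : ℝ) : EReal) - (ε : EReal) := EReal.sub_le_sub hE le_rfl
    _ = ((e - ε / 2 : ℝ) : EReal) := by
        rw [← EReal.coe_sub]
        congr 1
        ring
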